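/- Let $H$ be a real infinite-dimensional separable Hilbert space (for instance $H=L^2([0,1])$) with orthonormal basis $(e_j)_{j\ge 1}$, let $n\ge 2$, and let $P$ be the $(n-2)\times n$ matrix of the second difference, $(Py)_i=y_{i+2}-2y_{i+1}+y_i$; real matrices act on vectors with entries in $H$ in the obvious way. Let $\Sigma_u h=\sum_j\mu_j\langle h,e_j\rangle e_j$ and $\Sigma_v h=\sum_j\tau_j\langle h,e_j\rangle e_j$ with $\mu_j,\tau_j>0$, $\sum_j\mu_j<\infty$, $\sum_j\tau_j<\infty$. Let $U_1,\dots,U_n$ be i.i.d. centred Gaussian $H$-valued random variables with covariance operator $\Sigma_u$, let $V_1,\dots,V_{n-2}$ be i.i.d. centred Gaussian $H$-valued random variables with covariance operator $\Sigma_v$, and let the vectors $U=(U_i)_i$ and $V=(V_i)_i$ be independent. Let $Y_0=Z\gamma$ be deterministic, where $Z$ is a real $n\times 2$ matrix with $PZ=0$, $Z'Z=I_2$, and $\gamma\in H\times H$. Put $$Y=Y_0+P'(PP')^{-1}V,\qquad X=Y+U .$$ For a linear operator $B$ in $H$ with domain $D(B)$ and $x\in H^n$ let $Y(B,x)$ be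 the minimizer of $$y\mapsto\sum_{i=1}^n\|x_i-y_i\|^2+\sum_{i=1}^{n-2}\langle (Py)_i,B(Py)_i\rangle$$ over all $y\in H^n$ with $(Py)_i\in D(B)$ for all $i$. Let $\mathcal B$ be the set of all bounded linear $B:H\to H$ with $\langle h,Bh\rangle\ge 0$ for all $h$, and let $\hat B$ be the operator $$\hat B h=\sum_{j}\frac{\mu_j}{\tau_j}\langle h,e_j\rangle e_j,\qquad D(\hat B)=\Big\{h:\ \sum_j\big(\tfrac{\mu_j}{\tau_j}\big)^2\langle h,e_j\rangle^2<\infty\Big\}.$$ Then: 1. $\Sigma_v$ is injective and $\hat B$ extends $\Sigma_u\Sigma_v^{-1}$, that is, $\hat B\Sigma_v h=\Sigma_u h$ for all $h\in H$; and $\langle h,\hat Bh\rangle\ge0$ for $h\in D(\hat B)$. 2. For every $x\in H^n$ the minimizer $Y(\hat B,x)$, and for every $B\in\mathcal B$ the minimizer $Y(B,x)$, exists and is unique. 3. Almost surely, $\|E[Y|X]-Y(\hat B,X)\|^2\le\|E[Y|X]-Y(B,X)\|^2$ for all $B\in\mathcal B$ simultaneously, with the norm of $H^n$. 4. $Y$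 and the squared norms in 3 are integrable, and with $J(B)=E\,\|E[Y|X]-Y(B,X)\|^2$ one has $J(\hat B)=\inf_{B\in\mathcal B}J(B)$. If $n\ge3$, then $J(\hat B)<J(B)$ for every self-adjoint $B\in\mathcal B$ with $B\neq\hat B$. 5. $\hat B$ belongs to $\mathcal B$, and then minimizes $J$ over $\mathcal B$, if and only if $\sup_j\mu_j/\tau_j<\infty$. -/

import Mathlib

open MeasureTheory ProbabilityTheory Set
open scoped RealInnerProductSpace

noncomputable section

namespace FunctionalHP

variable {H : Type*} [NormedAddCommGroup H] [InnerProductSpace ℝ H]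

/-- The `m × (m+2)` matrix of the second order differencing operator,
`(P y)_i = y_{i+2} - 2 y_{i+1} + y_i`. (The time series has `n = m + 2` entries.) -/
def secondDiff (m : ℕ) : Matrix (Fin m) (Fin (m + 2)) ℝ :=
  Matrix.of fun i k =>
    if (k : ℕ) = i then 1 else if (k : ℕ) = i + 1 then -2 else if (k : ℕ) = i + 2 then 1 else 0

/-- A real matrix acting on a vector with entries in `H`: `(M v)_i = ∑ k, M i k • v k`. -/
def matAct {ι κ : Type*} [Fintype κ] (M : Matrix ι κ ℝ) (v : κ → H) : ι → H :=
  fun i => ∑ k, M i k • v k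

section Diagonal

variable (e : HilbertBasis ℕ ℝ H)

theorem summable_diag {a : ℕ → ℝ} {h : H} (hh : Summable fun j => (a j * ⟪e j, h⟫) ^ 2) :
    Summable fun j => (a j * ⟪e j, h⟫) • e j := by
  have hm : Memℓp (fun j => a j * ⟪e j, h⟫) 2 := by
    rw [memℓp_gen_iff (by norm_num)]
    refine hh.congr fun j => ?_
    simp [Real.norm_eq_abs, ← abs_mul]
  exact (e.hasSum_repr_symm ⟨_, hm⟩).summable

theorem summable_sq_add {f g : ℕ → ℝ} (hf : Summable fun j => f j ^ 2)
    (hg : Summable fun j => g j ^ 2) : Summable fun j => (f j + g j) ^ 2 := by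
  refine Summable.of_nonneg_of_le (fun j => sq_nonneg _) (fun j => ?_)
    ((hf.add hg).mul_left 2)
  nlinarith [sq_nonneg (f j - g j)]

/-- The (possibly unbounded) diagonal operator `h ↦ ∑ j, a j ⟨h, e j⟩ e j`, on its maximal domain
`{h | ∑ j, (a j ⟨h, e j⟩)² < ∞}`, that is, for all `h` for which the series converges in `H`. -/
def diagOp (a : ℕ → ℝ) : H →ₗ.[ℝ] H where
  domain :=
    { carrier := {h | Summable fun j => (a j * ⟪e j, h⟫) ^ 2}
      add_mem' := by
        intro g h hg hh
        have := summable_sq_add hg hh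
        simpa only [mem_ofPred_eq, inner_add_right, mul_add] using this
      zero_mem' := by simp
      smul_mem' := by
        intro c h hh
        have := Summable.mul_left (c ^ 2) hh
        refine this.congr fun j => ?_
        rw [real_inner_smul_right]
        ring }
  toFun :=
    { toFun := fun h => ∑' j, (a j * ⟪e j, (h : H)⟫) • e j
      map_add' := by
        intro g h
        rw [← (summable_diag e g.2).tsum_add (summable_diag e h.2)]
        refine tsum_congr fun j => ?_
        rw [Submodule.coe_add, inner_add_right, mul_add, add_smul]
      map_smul' := by
        intro c h
        rw [RingHom.id_apply, ← (summable_diag e h.2).tsum_const_smul c]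
        refine tsum_congr fun j => ?_
        rw [Submodule.coe_smul, real_inner_smul_right, smul_smul]
        congr 1
        ring }

/-- `S` is the positive definite trace class operator `S h = ∑ j, s j ⟨h, e j⟩ e j`, with
eigenvalues `s j > 0` and finite trace `∑ j, s j`. -/
structure IsDiagonalCovariance (S : H →L[ℝ] H) (s : ℕ → ℝ) : Prop where
  pos : ∀ j, 0 < s j
  summable : Summable s
  hasSum : ∀ h, HasSum (fun j => (s j * ⟪e j, h⟫) • e j) (S h)

end Diagonal

/-- The bounded operators `B` (defined on all of `H`) with `⟨h, B h⟩ ≥ 0` for all `h`. -/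
def smoothingOps (H : Type*) [NormedAddCommGroup H] [InnerProductSpace ℝ H] : Set (H →L[ℝ] H) :=
  {B | ∀ h, 0 ≤ ⟪h, B h⟫}

/-- A bounded operator, seen as a partially defined operator whose domain is all of `H`. -/
def everywhere (B : H →L[ℝ] H) : H →ₗ.[ℝ] H := (B : H →ₗ[ℝ] H).toPMap ⊤

/-- The Hodrick-Prescott functional `∑ i, ‖x_i - y_i‖² + ∑ i, ⟨(P y)_i, B (P y)_i⟩`. -/
def hpCost {m : ℕ} (B : H →ₗ.[ℝ] H) (x y : Fin (m + 2) → H)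
    (hy : ∀ i, matAct (secondDiff m) y i ∈ B.domain) : ℝ :=
  ∑ i, ‖x i - y i‖ ^ 2 +
    ∑ i, ⟪matAct (secondDiff m) y i, B ⟨matAct (secondDiff m) y i, hy i⟩⟫

/-- `y` minimizes the Hodrick-Prescott functional among all `y` with `(P y)_i` in the domain of `B`
(no restriction on `y` if `B` is everywhere defined). -/
def IsSmoothSignal {m : ℕ} (B : H →ₗ.[ℝ] H) (x y : Fin (m + 2) → H) : Prop :=
  ∃ hy, ∀ z hz, hpCost B x y hy ≤ hpCost B x z hz

/-- The optimal smooth signal `Y(B, x)`: the minimizer of the Hodrick-Prescott functional. -/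
def smoothSignal {m : ℕ} (B : H →ₗ.[ℝ] H) (x : Fin (m + 2) → H) : Fin (m + 2) → H :=
  Classical.epsilon (IsSmoothSignal B x)

section Probability

variable {Ω : Type*} [MeasurableSpace Ω] [MeasurableSpace H]

/-- `W` is a finite family of independent centred Gaussian `H`-valued random variables, each with
covariance operator `S` (hence identically distributed). -/
structure IsGaussianNoise [BorelSpace H] {k : ℕ} (P : Measure Ω) (W : Fin k → Ω → H)
    (S : H →L[ℝ] H) : Prop where
  measurable : ∀ i, Measurable (W i)
  indep : iIndepFun W P
  gaussian : ∀ i, HasGaussianLaw (W i) P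
  mean_zero : ∀ i, ∫ ω, W i ω ∂P = 0
  covariance : ∀ i g h, ∫ ω, ⟪W i ω, g⟫ * ⟪W i ω, h⟫ ∂P = ⟪S g, h⟫

/-- The signal `Y = Y₀ + P' (P P')⁻¹ V`. -/
def signal {m : ℕ} (Y₀ : Fin (m + 2) → H) (V : Fin m → Ω → H) (ω : Ω) : Fin (m + 2) → H :=
  Y₀ + matAct ((secondDiff m).transpose * (secondDiff m * (secondDiff m).transpose)⁻¹)
    (fun i => V i ω)

/-- The observation `X = Y + U`. -/
def observation {m : ℕ} (Y₀ : Fin (m + 2) → H) (U : Fin (m + 2) → Ω → H) (V : Fin m → Ω → H)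
    (ω : Ω) : Fin (m + 2) → H :=
  signal Y₀ V ω + fun i => U i ω

/-- The squared distance `‖E[Y|X] - Y(B, X)‖²` in `Hⁿ`, as a random variable. -/
def loss [CompleteSpace H] {m : ℕ} (P : Measure Ω) (X Y : Ω → Fin (m + 2) → H) (B : H →ₗ.[ℝ] H)
    (ω : Ω) : ℝ :=
  ∑ i, ‖(P[Y | MeasurableSpace.comap X inferInstance]) ω i - smoothSignal B (X ω) i‖ ^ 2

/-- The mean square distance `E ‖E[Y|X] - Y(B, X)‖²`. -/
def meanLoss [CompleteSpace H] {m : ℕ} (P : Measure Ω) (X Y : Ω → Fin (m + 2) → H)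
    (B : H →ₗ.[ℝ] H) : ℝ :=
  ∫ ω, loss P X Y B ω ∂P

end Probability

end FunctionalHP

end

/-! Let `P` be the second difference matrix, `G = Pᵀ(PPᵀ)⁻¹`, and `Q = GP` the orthogonal projection
onto the range of `Pᵀ`. For a positive symmetric `T`, possibly unbounded, completing the square
shows that a solution of the normal equation `y + PᵀTPy = x` is the only minimizer. Solutions exist
for bounded `T` by a Lax–Milgram argument, and for diagonal `T` coordinate by coordinate. The
solution map `S_T` is linear, nonexpansive in the Hilbert norm of `Hⁿ` and self-adjoint; it commutes
with `Q` and satisfies `(1 - Q) S_T = 1 - Q`. A nonsymmetric bounded `B` is replaced by its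
symmetric part, since the functional only sees the quadratic form.

The heart is `condExp_signal`: `E[Y|X] = Y₀ + Q S X`, with `S` the smoother of the noise-to-signal
operator. For `b` in `Hⁿ` put `y = G Sv Gᵀ b`, which represents the covariance of `Y` with `⟨b, X⟩`.
Then `Py = Sv Gᵀ b`, so the operator maps `Py` to `Su Gᵀ b`, and the normal equation reads `S (y + Q
Su b) = y`. This says exactly that the centred residual is uncorrelated with `X`; joint Gaussianity
makes it independent of `X` (`indepFun_residual`).

All smoothers act alike on the complement of the range of `Pᵀ`. Hence the error `E[Y|X] - S_T X`
splits orthogonally into `Y₀ + QX - X`, free of `T`, and `S X - S_T X` (`pairing_error_eq`), and the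
loss is `baseLoss` plus a nonnegative `gap` that vanishes at the optimal operator. This gives
optimality almost surely and in mean. As the optimal operator may be unbounded, the infimum is
approached by finite rank truncations, whose smoothers converge strongly. For strictness, a zero
mean gap forces `S - S_B` to annihilate `X` almost surely; the nondegenerate noise `U` then gives `S
= S_B`, and the smoother determines the operator. -/

noncomputable section

namespace FunctionalHP

/-! ### Real matrices acting on `Hⁿ`, and the inner product of `Hⁿ`. -/

section Algebra

variable {H : Type*} [NormedAddCommGroup H] [InnerProductSpace ℝ H]
variable {ι κ l : Type*}

theorem matAct_add [Fintype κ] (M : Matrix ι κ ℝ) (v w : κ → H) :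
    matAct M (v + w) = matAct M v + matAct M w := by
  ext i
  simp [matAct, Finset.sum_add_distrib]

theorem matAct_smul [Fintype κ] (M : Matrix ι κ ℝ) (c : ℝ) (v : κ → H) :
    matAct M (c • v) = c • matAct M v := by
  ext i
  simp [matAct, Finset.smul_sum, smul_comm c]

/-- The action of a real matrix on vectors with entries in `H`, as a continuous linear map. -/
def matActCLM [Fintype κ] (M : Matrix ι κ ℝ) : (κ → H) →L[ℝ] (ι → H) where
  toFun := matAct M
  map_add' := matAct_add M
  map_smul' := matAct_smul M
  cont := by
    unfold matAct
    fun_prop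

theorem matActCLM_apply [Fintype κ] (M : Matrix ι κ ℝ) (v : κ → H) :
    matActCLM M v = matAct M v := rfl

theorem matAct_sub [Fintype κ] (M : Matrix ι κ ℝ) (v w : κ → H) :
    matAct M (v - w) = matAct M v - matAct M w := map_sub (matActCLM M) v w

theorem matAct_zero [Fintype κ] (M : Matrix ι κ ℝ) : matAct M (0 : κ → H) = 0 :=
  map_zero (matActCLM M)

theorem zero_matAct [Fintype κ] (v : κ → H) : matAct (0 : Matrix ι κ ℝ) v = 0 := by
  ext i
  simp [matAct]

theorem matAct_mul [Fintype κ] [Fintype l] (M : Matrix ι κ ℝ) (N : Matrix κ l ℝ) (v : l → H) :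
    matAct (M * N) v = matAct M (matAct N v) := by
  ext i
  simp only [matAct, Matrix.mul_apply, Finset.sum_smul, Finset.smul_sum, smul_smul]
  exact Finset.sum_comm

theorem one_matAct [Fintype κ] [DecidableEq κ] (v : κ → H) :
    matAct (1 : Matrix κ κ ℝ) v = v := by
  ext i
  simp [matAct, Matrix.one_apply]

theorem inner_matAct [Fintype κ] (M : Matrix ι κ ℝ) (v : κ → H) (h : H) (i : ι) :
    ⟪h, matAct M v i⟫ = matAct M (fun k => ⟪h, v k⟫) i := by
  simp [matAct, inner_sum, real_inner_smul_right]

/-- A continuous linear operator commutes with the action of a real matrix. -/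
theorem matAct_map [Fintype κ] (M : Matrix ι κ ℝ) (S : H →L[ℝ] H) (v : κ → H) (i : ι) :
    matAct M (fun k => S (v k)) i = S (matAct M v i) := by
  simp [matAct]

variable [Fintype ι] [Fintype κ]

/-- The inner product of two vectors with entries in `H`. -/
def pairing (x y : ι → H) : ℝ := ∑ i, ⟪x i, y i⟫

theorem pairing_comm (x y : ι → H) : pairing x y = pairing y x :=
  Finset.sum_congr rfl fun _ _ => real_inner_comm _ _

theorem pairing_add_left (x y z : ι → H) : pairing (x + y) z = pairing x z + pairing y z := by
  simp [pairing, inner_add_left, Finset.sum_add_distrib]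

theorem pairing_add_right (x y z : ι → H) : pairing z (x + y) = pairing z x + pairing z y := by
  simp [pairing, inner_add_right, Finset.sum_add_distrib]

theorem pairing_sub_left (x y z : ι → H) : pairing (x - y) z = pairing x z - pairing y z := by
  simp [pairing, inner_sub_left, Finset.sum_sub_distrib]

theorem pairing_sub_right (x y z : ι → H) : pairing z (x - y) = pairing z x - pairing z y := by
  simp [pairing, inner_sub_right, Finset.sum_sub_distrib]

theorem pairing_zero_right (x : ι → H) : pairing x 0 = 0 := by simp [pairing]

theorem pairing_self (x : ι → H) : pairing x x = ∑ i, ‖x i‖ ^ 2 := by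
  simp [pairing]

theorem pairing_self_nonneg (x : ι → H) : 0 ≤ pairing x x := by
  rw [pairing_self]
  positivity

theorem eq_zero_of_pairing_self_le {x : ι → H} (h : pairing x x ≤ 0) : x = 0 := by
  have h0 : ∑ i, ‖x i‖ ^ 2 = 0 := by
    rw [← pairing_self]
    exact le_antisymm h (pairing_self_nonneg x)
  rw [Finset.sum_eq_zero_iff_of_nonneg fun i _ => by positivity] at h0
  ext i
  simpa using h0 i (Finset.mem_univ i)

theorem pairing_matAct (M : Matrix ι κ ℝ) (x : κ → H) (y : ι → H) :
    pairing (matAct M x) y = pairing x (matAct M.transpose y) := by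
  simp only [pairing, matAct, sum_inner, inner_sum, real_inner_smul_left, real_inner_smul_right,
    Matrix.transpose_apply]
  exact Finset.sum_comm

theorem norm_sq_le_pairing_self (x : ι → H) : ‖x‖ ^ 2 ≤ pairing x x := by
  rw [pairing_self]
  refine (Real.le_sqrt (norm_nonneg _) (by positivity)).1 ?_
  refine (pi_norm_le_iff_of_nonneg (Real.sqrt_nonneg _)).2 fun i => ?_
  refine Real.le_sqrt_of_sq_le ?_
  exact Finset.single_le_sum (f := fun i => ‖x i‖ ^ 2) (fun i _ => by positivity)
    (Finset.mem_univ i)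

theorem pairing_self_le (x : ι → H) : pairing x x ≤ Fintype.card ι * ‖x‖ ^ 2 := by
  rw [pairing_self]
  refine (Finset.sum_le_card_nsmul _ _ (‖x‖ ^ 2) fun i _ => ?_).trans ?_
  · gcongr
    exact norm_le_pi_norm x i
  · simp

/-- Every continuous linear functional on `ι → H` is a pairing. -/
theorem exists_pairing_eq [CompleteSpace H] (f : StrongDual ℝ (ι → H)) :
    ∃ a : ι → H, ∀ x, f x = pairing a x := by
  classical
  refine ⟨fun i => (InnerProductSpace.toDual ℝ H).symm
    (f ∘L ContinuousLinearMap.single ℝ (fun _ => H) i), fun x => ?_⟩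
  simp only [pairing, InnerProductSpace.toDual_symm_apply, ContinuousLinearMap.comp_apply]
  rw [← map_sum]
  congr 1
  exact (Finset.univ_sum_single x).symm

end Algebra

/-! ### The second difference matrix, its right inverse and its projection. -/

section SecondDiff

/-- Entry `k < m` of `Pᵀ v` is `v k` plus multiples of the two preceding entries, so the system is
unit triangular and is solved by forward substitution. -/
theorem secondDiff_transpose_mulVec_injective (m : ℕ) :
    Function.Injective (secondDiff m).transpose.mulVec := by
  rw [← Matrix.coe_mulVecLin, injective_iff_map_eq_zero]
  intro v hv
  suffices h : ∀ (k : ℕ) (hk : k < m), v ⟨k, hk⟩ = 0 by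
    ext i
    exact h i i.2
  intro k
  induction k using Nat.strong_induction_on with
  | _ k ih =>
    intro hk
    have h := congrFun hv ⟨k, by omega⟩
    simp only [Matrix.mulVecLin_apply, Matrix.mulVec, dotProduct, Matrix.transpose_apply,
      secondDiff, Matrix.of_apply, Pi.zero_apply] at h
    rw [Finset.sum_eq_single_of_mem ⟨k, hk⟩ (Finset.mem_univ _)] at h
    · simpa using h
    · intro i _ hi
      have hne : (i : ℕ) ≠ k := fun hh => hi (Fin.ext hh)
      rcases lt_or_gt_of_ne hne with hlt | hgt
      · rw [show v i = 0 from ih i hlt i.2, mul_zero]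
      · rw [if_neg (by omega), if_neg (by omega), if_neg (by omega), zero_mul]

theorem isUnit_det_secondDiff_gram (m : ℕ) :
    IsUnit (secondDiff m * (secondDiff m).transpose).det := by
  have h := Matrix.PosDef.mul_conjTranspose_self (secondDiff m) (by
    intro v w hvw
    apply secondDiff_transpose_mulVec_injective m
    simpa [Matrix.mulVec_transpose] using hvw)
  rw [Matrix.conjTranspose_eq_transpose_of_trivial] at h
  exact h.isUnit.map Matrix.detMonoidHom

/-- The right inverse `Pᵀ (P Pᵀ)⁻¹` of the second difference matrix. -/
def pinv (m : ℕ) : Matrix (Fin (m + 2)) (Fin m) ℝ :=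
  (secondDiff m).transpose * (secondDiff m * (secondDiff m).transpose)⁻¹

/-- The orthogonal projection onto the range of `Pᵀ`. -/
def rangeProj (m : ℕ) : Matrix (Fin (m + 2)) (Fin (m + 2)) ℝ := pinv m * secondDiff m

theorem secondDiff_mul_pinv (m : ℕ) : secondDiff m * pinv m = 1 := by
  rw [pinv, ← Matrix.mul_assoc, Matrix.mul_nonsing_inv _ (isUnit_det_secondDiff_gram m)]

theorem secondDiff_mul_rangeProj (m : ℕ) : secondDiff m * rangeProj m = secondDiff m := by
  rw [rangeProj, ← Matrix.mul_assoc, secondDiff_mul_pinv, Matrix.one_mul]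

theorem rangeProj_transpose (m : ℕ) : (rangeProj m).transpose = rangeProj m := by
  simp [rangeProj, pinv, Matrix.transpose_mul, Matrix.transpose_nonsing_inv, Matrix.mul_assoc]

theorem rangeProj_mul_transpose (m : ℕ) :
    rangeProj m * (secondDiff m).transpose = (secondDiff m).transpose := by
  rw [← rangeProj_transpose, ← Matrix.transpose_mul, secondDiff_mul_rangeProj]

theorem transpose_mul_pinv_transpose (m : ℕ) :
    (secondDiff m).transpose * (pinv m).transpose = rangeProj m := by
  rw [← Matrix.transpose_mul, ← rangeProj_transpose, rangeProj]

theorem rangeProj_mul_pinv (m : ℕ) : rangeProj m * pinv m = pinv m := by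
  rw [rangeProj, Matrix.mul_assoc, secondDiff_mul_pinv, Matrix.mul_one]

theorem pinv_transpose_mul_transpose (m : ℕ) :
    (pinv m).transpose * (secondDiff m).transpose = 1 := by
  rw [← Matrix.transpose_mul, secondDiff_mul_pinv, Matrix.transpose_one]

end SecondDiff

/-! ### The normal equation and its solution map, for partially defined operators. -/

section NormalEquation

variable {H : Type*} [NormedAddCommGroup H] [InnerProductSpace ℝ H] {m : ℕ}

/-- `y` solves the normal equation `y + Pᵀ T P y = x` of the Hodrick-Prescott functional. -/
def SolvesNormalEq (T : H →ₗ.[ℝ] H) (x y : Fin (m + 2) → H) : Prop :=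
  ∃ hy : ∀ i, matAct (secondDiff m) y i ∈ T.domain,
    y + matAct (secondDiff m).transpose (fun i => T ⟨matAct (secondDiff m) y i, hy i⟩) = x

/-- `T` is positive and symmetric, and its normal equation is solvable. -/
structure IsAdmissible (m : ℕ) (T : H →ₗ.[ℝ] H) : Prop where
  nonneg : ∀ h : T.domain, 0 ≤ ⟪(h : H), T h⟫
  symm : ∀ g h : T.domain, ⟪T g, (h : H)⟫ = ⟪(g : H), T h⟫
  solvable : ∀ x : Fin (m + 2) → H, ∃ y, SolvesNormalEq T x y

theorem hpCost_eq_pairing (T : H →ₗ.[ℝ] H) (x y : Fin (m + 2) → H)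
    (hy : ∀ i, matAct (secondDiff m) y i ∈ T.domain) :
    hpCost T x y hy = pairing (x - y) (x - y) +
      pairing (matAct (secondDiff m) y) fun i => T ⟨matAct (secondDiff m) y i, hy i⟩ := by
  rw [pairing_self]
  rfl

theorem SolvesNormalEq.add {T : H →ₗ.[ℝ] H} {x x' y y' : Fin (m + 2) → H}
    (h : SolvesNormalEq T x y) (h' : SolvesNormalEq T x' y') :
    SolvesNormalEq T (x + x') (y + y') := by
  obtain ⟨hy, rfl⟩ := h
  obtain ⟨hy', rfl⟩ := h'
  have hmem : ∀ i, matAct (secondDiff m) (y + y') i ∈ T.domain := fun i => by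
    rw [matAct_add]
    exact T.domain.add_mem (hy i) (hy' i)
  refine ⟨hmem, ?_⟩
  have : (fun i => T ⟨matAct (secondDiff m) (y + y') i, hmem i⟩) =
      (fun i => T ⟨matAct (secondDiff m) y i, hy i⟩) +
        fun i => T ⟨matAct (secondDiff m) y' i, hy' i⟩ := by
    ext i
    rw [Pi.add_apply, ← T.map_add]
    exact congrArg T (Subtype.ext (congrFun (matAct_add _ y y') i))
  rw [this, matAct_add]
  abel

theorem SolvesNormalEq.smul {T : H →ₗ.[ℝ] H} {x y : Fin (m + 2) → H} (c : ℝ)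
    (h : SolvesNormalEq T x y) : SolvesNormalEq T (c • x) (c • y) := by
  obtain ⟨hy, rfl⟩ := h
  have hmem : ∀ i, matAct (secondDiff m) (c • y) i ∈ T.domain := fun i => by
    rw [matAct_smul]
    exact T.domain.smul_mem c (hy i)
  refine ⟨hmem, ?_⟩
  have : (fun i => T ⟨matAct (secondDiff m) (c • y) i, hmem i⟩) =
      c • fun i => T ⟨matAct (secondDiff m) y i, hy i⟩ := by
    ext i
    rw [Pi.smul_apply, ← T.map_smul]
    exact congrArg T (Subtype.ext (congrFun (matAct_smul _ c y) i))
  rw [this, matAct_smul, smul_add]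

theorem SolvesNormalEq.sub {T : H →ₗ.[ℝ] H} {x x' y y' : Fin (m + 2) → H}
    (h : SolvesNormalEq T x y) (h' : SolvesNormalEq T x' y') :
    SolvesNormalEq T (x - x') (y - y') := by
  have := h.add (h'.smul (-1))
  simpa [sub_eq_add_neg] using this

/-- The solution of the normal equation is no larger than its right hand side. -/
theorem SolvesNormalEq.pairing_self_le {T : H →ₗ.[ℝ] H}
    (hT : ∀ h : T.domain, 0 ≤ ⟪(h : H), T h⟫) {x y : Fin (m + 2) → H}
    (h : SolvesNormalEq T x y) : pairing y y ≤ pairing x x := by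
  obtain ⟨hy, rfl⟩ := h
  set w := fun i => T ⟨matAct (secondDiff m) y i, hy i⟩
  -- The squared norm of `y + Pᵀw` is that of `y` plus `2⟨Py, w⟩` plus that of `Pᵀw`, and positivity
  -- of `T` is `⟨Py, w⟩ ≥ 0`.
  have h1 : 0 ≤ pairing (matAct (secondDiff m) y) w :=
    Finset.sum_nonneg fun i _ => hT ⟨_, hy i⟩
  rw [pairing_matAct] at h1
  have h2 := pairing_self_nonneg (matAct (secondDiff m).transpose w)
  simp only [pairing_add_left, pairing_add_right]
  rw [pairing_comm (matAct _ _) y]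
  linarith

/-- Completing the square around the solution of the normal equation. -/
theorem SolvesNormalEq.hpCost_add_le {T : H →ₗ.[ℝ] H}
    (hT : ∀ h : T.domain, 0 ≤ ⟪(h : H), T h⟫)
    (hs : ∀ g h : T.domain, ⟪T g, (h : H)⟫ = ⟪(g : H), T h⟫) {x y : Fin (m + 2) → H}
    (h : SolvesNormalEq T x y) (hy : ∀ i, matAct (secondDiff m) y i ∈ T.domain)
    (z : Fin (m + 2) → H) (hz : ∀ i, matAct (secondDiff m) z i ∈ T.domain) :
    hpCost T x y hy + pairing (z - y) (z - y) ≤ hpCost T x z hz := by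
  obtain ⟨_, hx⟩ := h
  have hd : ∀ i, matAct (secondDiff m) (z - y) i ∈ T.domain := fun i => by
    rw [matAct_sub]
    exact T.domain.sub_mem (hz i) (hy i)
  set d := z - y with hdz
  set w := fun i => T ⟨matAct (secondDiff m) y i, hy i⟩ with hw
  set v := fun i => T ⟨matAct (secondDiff m) d i, hd i⟩ with hv
  have hzd : z = y + d := by rw [hdz]; abel
  have hTz : (fun i => T ⟨matAct (secondDiff m) z i, hz i⟩) = w + v := by
    ext i
    rw [Pi.add_apply, hw, hv, ← T.map_add]
    exact congrArg T (Subtype.ext ((congrArg (fun u => matAct (secondDiff m) u i) hzd).trans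
      (congrFun (matAct_add _ y d) i)))
  have h1 : 0 ≤ pairing (matAct (secondDiff m) d) v :=
    Finset.sum_nonneg fun i _ => hT ⟨_, hd i⟩
  -- Symmetry of `T` turns the mixed penalty terms into `2⟨Pd, w⟩`. Since `x - y = Pᵀw`, this
  -- cancels the mixed term `-2⟨d, Pᵀw⟩` of the fit; what remains is `⟨d, d⟩ + ⟨Pd, v⟩`.
  have h2 : pairing (matAct (secondDiff m) y) v = pairing (matAct (secondDiff m) d) w := by
    rw [pairing_comm _ w]
    exact Finset.sum_congr rfl fun i _ => (hs ⟨_, hy i⟩ ⟨_, hd i⟩).symm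
  have h3 := pairing_matAct (secondDiff m) d w
  rw [hpCost_eq_pairing, hpCost_eq_pairing, hTz, ← hw]
  have e1 : x - z = matAct (secondDiff m).transpose w - d := by rw [← hx, hzd]; abel
  have e2 : x - y = matAct (secondDiff m).transpose w := by rw [← hx]; abel
  rw [e1, e2, hzd, matAct_add]
  simp only [pairing_add_left, pairing_add_right, pairing_sub_left, pairing_sub_right]
  rw [pairing_comm (matAct _ w) d]
  linarith

theorem SolvesNormalEq.isSmoothSignal {T : H →ₗ.[ℝ] H}
    (hT : ∀ h : T.domain, 0 ≤ ⟪(h : H), T h⟫)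
    (hs : ∀ g h : T.domain, ⟪T g, (h : H)⟫ = ⟪(g : H), T h⟫) {x y : Fin (m + 2) → H}
    (h : SolvesNormalEq T x y) : IsSmoothSignal T x y :=
  ⟨h.1, fun z hz => le_of_add_le_of_nonneg_left (h.hpCost_add_le hT hs h.1 z hz)
    (pairing_self_nonneg _)⟩

theorem SolvesNormalEq.eq_of_isSmoothSignal {T : H →ₗ.[ℝ] H}
    (hT : ∀ h : T.domain, 0 ≤ ⟪(h : H), T h⟫)
    (hs : ∀ g h : T.domain, ⟪T g, (h : H)⟫ = ⟪(g : H), T h⟫) {x y z : Fin (m + 2) → H}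
    (h : SolvesNormalEq T x y) (hz : IsSmoothSignal T x z) : z = y := by
  obtain ⟨hz, hmin⟩ := hz
  have h1 := h.hpCost_add_le hT hs h.1 z hz
  have h2 := hmin y h.1
  exact sub_eq_zero.1 (eq_zero_of_pairing_self_le (by linarith))

variable {T : H →ₗ.[ℝ] H}

theorem IsAdmissible.existsUnique (hT : IsAdmissible m T) (x : Fin (m + 2) → H) :
    ∃! y, IsSmoothSignal T x y := by
  obtain ⟨y, hy⟩ := hT.solvable x
  exact ⟨y, hy.isSmoothSignal hT.nonneg hT.symm,
    fun z hz => hy.eq_of_isSmoothSignal hT.nonneg hT.symm hz⟩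

/-- Existence makes the choice by `Classical.epsilon` a genuine minimizer, and uniqueness identifies
it. -/
theorem IsAdmissible.smoothSignal_eq (hT : IsAdmissible m T) {x y : Fin (m + 2) → H}
    (h : SolvesNormalEq T x y) : smoothSignal T x = y :=
  h.eq_of_isSmoothSignal hT.nonneg hT.symm
    (Classical.epsilon_spec (⟨y, h.isSmoothSignal hT.nonneg hT.symm⟩ : ∃ z, IsSmoothSignal T x z))

theorem IsAdmissible.solves (hT : IsAdmissible m T) (x : Fin (m + 2) → H) :
    SolvesNormalEq T x (smoothSignal T x) := by
  obtain ⟨y, hy⟩ := hT.solvable x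
  rwa [hT.smoothSignal_eq hy]

/-- The map `x ↦ Y(T, x)`, as a continuous linear map. -/
def IsAdmissible.smoother (hT : IsAdmissible m T) :
    (Fin (m + 2) → H) →L[ℝ] (Fin (m + 2) → H) :=
  LinearMap.mkContinuous
    { toFun := smoothSignal T
      map_add' := fun x y => hT.smoothSignal_eq ((hT.solves x).add (hT.solves y))
      map_smul' := fun c x => hT.smoothSignal_eq ((hT.solves x).smul c) }
    -- The map is nonexpansive for `pairing`; the constant is the price of the sup norm carried by
    -- the function space `Fin (m + 2) → H`.
    (Real.sqrt (m + 2)) fun x => by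
      refine le_of_sq_le_sq ?_ (by positivity)
      rw [mul_pow, Real.sq_sqrt (by positivity)]
      refine (norm_sq_le_pairing_self _).trans
        (((hT.solves x).pairing_self_le hT.nonneg).trans ((pairing_self_le x).trans_eq ?_))
      simp

theorem IsAdmissible.smoother_apply (hT : IsAdmissible m T) (x : Fin (m + 2) → H) :
    hT.smoother x = smoothSignal T x := rfl

theorem IsAdmissible.smoother_eq (hT : IsAdmissible m T) {x y : Fin (m + 2) → H}
    (h : SolvesNormalEq T x y) : hT.smoother x = y := hT.smoothSignal_eq h

/-- With `x = y + PᵀTPy` and `z = w + PᵀTPw`, the two sides are `⟨y, w⟩ + ⟨Py, TPw⟩` and `⟨y, w⟩ +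
⟨TPy, Pw⟩`. -/
theorem IsAdmissible.pairing_smoother (hT : IsAdmissible m T) (x z : Fin (m + 2) → H) :
    pairing (hT.smoother x) z = pairing x (hT.smoother z) := by
  obtain ⟨y, hy⟩ := hT.solvable x
  obtain ⟨w, hw⟩ := hT.solvable z
  rw [hT.smoother_eq hy, hT.smoother_eq hw]
  obtain ⟨hy, rfl⟩ := hy
  obtain ⟨hw, rfl⟩ := hw
  rw [pairing_add_left, pairing_add_right, ← pairing_matAct, pairing_comm (matAct _ _) w,
    ← pairing_matAct, pairing_comm (matAct _ w)]
  congr 1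
  exact Finset.sum_congr rfl fun i _ => (hT.symm ⟨_, hy i⟩ ⟨_, hw i⟩).symm

/-- The smoother commutes with the orthogonal projection onto the range of `Pᵀ`. -/
theorem IsAdmissible.smoother_rangeProj (hT : IsAdmissible m T) (x : Fin (m + 2) → H) :
    hT.smoother (matAct (rangeProj m) x) = matAct (rangeProj m) (hT.smoother x) := by
  obtain ⟨y, hy⟩ := hT.solvable x
  rw [hT.smoother_eq hy]
  apply hT.smoother_eq
  obtain ⟨hy, rfl⟩ := hy
  have hP : matAct (secondDiff m) (matAct (rangeProj m) y) = matAct (secondDiff m) y := by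
    rw [← matAct_mul, secondDiff_mul_rangeProj]
  refine ⟨fun i => by rw [hP]; exact hy i, ?_⟩
  simp only [hP, matAct_add]
  rw [← matAct_mul (rangeProj m), rangeProj_mul_transpose]

/-- Smoothing does not change the part of `x` orthogonal to the range of `Pᵀ`. -/
theorem IsAdmissible.sub_rangeProj_smoother (hT : IsAdmissible m T) (x : Fin (m + 2) → H) :
    hT.smoother x - matAct (rangeProj m) (hT.smoother x) = x - matAct (rangeProj m) x := by
  obtain ⟨y, hy⟩ := hT.solvable x
  rw [hT.smoother_eq hy]
  obtain ⟨hy, rfl⟩ := hy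
  rw [matAct_add, ← matAct_mul (rangeProj m), rangeProj_mul_transpose]
  abel

end NormalEquation

/-! ### Bounded operators: solvability and reduction to the symmetric part. -/

section Bounded

variable {H : Type*} [NormedAddCommGroup H] [InnerProductSpace ℝ H]

theorem mem_everywhere_domain (B : H →L[ℝ] H) (h : H) : h ∈ (everywhere B).domain :=
  Submodule.mem_top

theorem everywhere_apply (B : H →L[ℝ] H) (h : (everywhere B).domain) :
    everywhere B h = B h := rfl

variable [CompleteSpace H] {m : ℕ}

/-- A continuous linear map `A` of `ι → H` with `⟨A x, x⟩ ≥ ⟨x, x⟩` is onto. -/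
theorem surjective_of_pairing_le {ι : Type*} [Fintype ι] (A : (ι → H) →L[ℝ] (ι → H))
    (hA : ∀ x, pairing x x ≤ pairing (A x) x) : Function.Surjective A := by
  -- The sup norm on `ι → H` is not Hilbertian, so coercivity is exploited on the `ℓ²` product.
  let E := PiLp.continuousLinearEquiv 2 ℝ (fun _ : ι => H)
  let A' : PiLp 2 (fun _ : ι => H) →L[ℝ] PiLp 2 (fun _ : ι => H) :=
    E.symm.toContinuousLinearMap ∘L A ∘L E.toContinuousLinearMap
  have hu : IsUnit A' := by
    refine ContinuousLinearMap.isUnit_of_forall_le_norm_inner_map A' (c := 1) one_pos fun x => ?_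
    refine le_trans ?_ (le_abs_self _)
    have h := hA (E x)
    rw [pairing_self] at h
    rw [PiLp.norm_sq_eq_of_L2, NNReal.coe_one, mul_one, PiLp.inner_apply]
    exact h
  have hs := (ContinuousLinearMap.isUnit_iff_bijective.1 hu).2
  intro y
  obtain ⟨x, hx⟩ := hs (E.symm y)
  exact ⟨E x, E.symm.injective hx⟩

/-- Positivity of `B` makes `1 + PᵀBP` coercive with constant `1`. -/
theorem isAdmissible_everywhere (m : ℕ) {B : H →L[ℝ] H} (hpos : ∀ h, 0 ≤ ⟪h, B h⟫)
    (hsymm : ∀ g h, ⟪B g, h⟫ = ⟪g, B h⟫) : IsAdmissible m (everywhere B) where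
  nonneg h := hpos h
  symm g h := hsymm g h
  solvable x := by
    let B' : (Fin m → H) →L[ℝ] (Fin m → H) :=
      ContinuousLinearMap.pi fun i => B ∘L ContinuousLinearMap.proj i
    obtain ⟨y, hy⟩ := surjective_of_pairing_le (ContinuousLinearMap.id ℝ _ +
      matActCLM (secondDiff m).transpose ∘L B' ∘L matActCLM (secondDiff m)) (fun y => by
        simp only [add_apply, ContinuousLinearMap.comp_apply,
          matActCLM_apply, ContinuousLinearMap.id_apply, pairing_add_left]
        rw [pairing_comm (matAct _ _), ← pairing_matAct]
        exact le_add_of_nonneg_right (Finset.sum_nonneg fun i _ => hpos _)) x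
    exact ⟨y, fun i => mem_everywhere_domain B _, hy⟩

/-- The symmetric part of a bounded operator. -/
def symmPart (B : H →L[ℝ] H) : H →L[ℝ] H := (1 / 2 : ℝ) • (B + B.adjoint)

theorem inner_symmPart (B : H →L[ℝ] H) (h : H) : ⟪h, symmPart B h⟫ = ⟪h, B h⟫ := by
  simp only [symmPart, smul_apply, add_apply,
    real_inner_smul_right, inner_add_right, ContinuousLinearMap.adjoint_inner_right]
  rw [real_inner_comm h (B h)]
  ring

theorem symmPart_symm (B : H →L[ℝ] H) (g h : H) : ⟪symmPart B g, h⟫ = ⟪g, symmPart B h⟫ := by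
  simp only [symmPart, smul_apply, add_apply,
    real_inner_smul_right, real_inner_smul_left, inner_add_right, inner_add_left,
    ContinuousLinearMap.adjoint_inner_right, ContinuousLinearMap.adjoint_inner_left]
  ring

/-- The Hodrick-Prescott functional sees only the symmetric part of a bounded operator. -/
theorem isSmoothSignal_symmPart (B : H →L[ℝ] H) :
    IsSmoothSignal (m := m) (everywhere (symmPart B)) = IsSmoothSignal (everywhere B) := by
  have h : ∀ (x y : Fin (m + 2) → H) hy hy',
      hpCost (everywhere (symmPart B)) x y hy = hpCost (everywhere B) x y hy' := by
    intro x y hy hy'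
    simp only [hpCost, everywhere_apply, inner_symmPart]
  ext x y
  simp only [IsSmoothSignal]
  constructor
  · rintro ⟨hy, hmin⟩
    refine ⟨fun i => mem_everywhere_domain B _, fun z hz => ?_⟩
    rw [← h x y hy, ← h x z fun i => mem_everywhere_domain _ _]
    exact hmin z _
  · rintro ⟨hy, hmin⟩
    refine ⟨fun i => mem_everywhere_domain _ _, fun z hz => ?_⟩
    rw [h x y _ hy, h x z _ fun i => mem_everywhere_domain _ _]
    exact hmin z _

theorem smoothSignal_symmPart (B : H →L[ℝ] H) :
    smoothSignal (m := m) (everywhere (symmPart B)) = smoothSignal (everywhere B) := by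
  ext x
  rw [smoothSignal, isSmoothSignal_symmPart, smoothSignal]

theorem isAdmissible_symmPart (m : ℕ) {B : H →L[ℝ] H} (hB : B ∈ smoothingOps H) :
    IsAdmissible m (everywhere (symmPart B)) :=
  isAdmissible_everywhere m (fun h => by rw [inner_symmPart]; exact hB h) (symmPart_symm B)

end Bounded

/-! ### Diagonal operators, diagonal covariances and finite rank truncations. -/

section Diagonal

variable {H : Type*} [NormedAddCommGroup H] [InnerProductSpace ℝ H] (e : HilbertBasis ℕ ℝ H)

theorem ext_inner_hilbertBasis {g h : H} (hgh : ∀ j, ⟪e j, g⟫ = ⟪e j, h⟫) : g = h := by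
  apply e.repr.injective
  ext j
  rw [e.repr_apply_apply, e.repr_apply_apply, hgh]

theorem summable_inner_sq (h : H) : Summable fun j => ⟪e j, h⟫ ^ 2 := by
  refine (e.summable_inner_mul_inner h h).congr fun j => ?_
  rw [real_inner_comm h (e j), sq]

/-- A square summable sequence is the sequence of coordinates of some vector. -/
theorem exists_inner_eq {f : ℕ → ℝ} (hf : Summable fun j => f j ^ 2) :
    ∃ h : H, ∀ j, ⟪e j, h⟫ = f j := by
  have hm : Memℓp f 2 := by
    rw [memℓp_gen_iff (by norm_num)]
    refine hf.congr fun j => ?_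
    simp [Real.norm_eq_abs]
  refine ⟨e.repr.symm ⟨f, hm⟩, fun j => ?_⟩
  rw [← e.repr_apply_apply, LinearIsometryEquiv.apply_symm_apply]

theorem inner_eq_of_hasSum {c : ℕ → ℝ} {h : H} (hh : HasSum (fun j => c j • e j) h) (k : ℕ) :
    ⟪e k, h⟫ = c k := by
  have h1 := hh.mapL (innerSL ℝ (e k))
  have h2 : HasSum (fun j => ⟪e k, c j • e j⟫) (c k) := by
    have := hasSum_single (f := fun j => ⟪e k, c j • e j⟫) k fun j hj => by
      rw [real_inner_smul_right, e.orthonormal.2 hj.symm, mul_zero]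
    simpa [real_inner_smul_right, real_inner_self_eq_norm_sq, e.orthonormal.1 k] using this
  exact h1.unique h2

variable {a : ℕ → ℝ}

theorem mem_diagOp_domain {h : H} :
    h ∈ (diagOp e a).domain ↔ Summable fun j => (a j * ⟪e j, h⟫) ^ 2 := Iff.rfl

theorem hasSum_diagOp (h : (diagOp e a).domain) :
    HasSum (fun j => (a j * ⟪e j, (h : H)⟫) • e j) (diagOp e a h) :=
  (summable_diag e h.2).hasSum

theorem inner_diagOp (h : (diagOp e a).domain) (j : ℕ) :
    ⟪e j, diagOp e a h⟫ = a j * ⟪e j, (h : H)⟫ :=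
  inner_eq_of_hasSum e (hasSum_diagOp e h) j

theorem diagOp_symm (g h : (diagOp e a).domain) :
    ⟪diagOp e a g, (h : H)⟫ = ⟪(g : H), diagOp e a h⟫ := by
  rw [← e.tsum_inner_mul_inner, ← e.tsum_inner_mul_inner (g : H)]
  refine tsum_congr fun j => ?_
  rw [real_inner_comm (e j), inner_diagOp, inner_diagOp, real_inner_comm (e j)]
  ring

theorem diagOp_nonneg (ha : ∀ j, 0 ≤ a j) (h : (diagOp e a).domain) :
    0 ≤ ⟪(h : H), diagOp e a h⟫ := by
  rw [← e.tsum_inner_mul_inner]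
  refine tsum_nonneg fun j => ?_
  rw [inner_diagOp, real_inner_comm (e j)]
  nlinarith [mul_nonneg (ha j) (sq_nonneg ⟪e j, (h : H)⟫)]

/-- The normal equation of a diagonal operator is solved coordinate by coordinate. -/
theorem isAdmissible_diagOp (m : ℕ) (ha : ∀ j, 0 ≤ a j) : IsAdmissible m (diagOp e a) where
  nonneg := diagOp_nonneg e ha
  symm := diagOp_symm e
  solvable x := by
    -- In the coordinate `j` the problem is the one for the Hilbert space `ℝ`, with multiplication
    -- by `a j`.
    have hreal : ∀ j, IsAdmissible m (everywhere (a j • ContinuousLinearMap.id ℝ ℝ)) := fun j =>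
      isAdmissible_everywhere m
        (fun h => by simpa [mul_assoc] using mul_nonneg (ha j) (mul_self_nonneg h))
        (fun g h => by simp; ring)
    choose w hw using fun j => (hreal j).solvable fun i => ⟪e j, x i⟫
    -- Nonexpansiveness bounds `w j` by the `j`-th coordinates of `x`, uniformly in the size of `a
    -- j`.
    have hsq : ∀ i, Summable fun j => w j i ^ 2 := fun i => by
      have hx : Summable fun j => ∑ k, ⟪e j, x k⟫ ^ 2 :=
        summable_sum fun k _ => summable_inner_sq e (x k)
      refine Summable.of_nonneg_of_le (fun j => sq_nonneg _) (fun j => ?_) hx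
      have h1 := (hw j).pairing_self_le (hreal j).nonneg
      simp only [pairing_self, Real.norm_eq_abs, sq_abs] at h1
      exact (Finset.single_le_sum (f := fun i => w j i ^ 2) (fun i _ => sq_nonneg _)
        (Finset.mem_univ i)).trans h1
    choose y hy using fun i => exists_inner_eq e (hsq i)
    have hPy : ∀ i j, ⟪e j, matAct (secondDiff m) y i⟫ = matAct (secondDiff m) (w j) i :=
      fun i j => by simp only [inner_matAct, hy]
    have heq : ∀ j, w j + matAct (secondDiff m).transpose
        (fun i => a j * matAct (secondDiff m) (w j) i) = fun i => ⟪e j, x i⟫ := fun j => (hw j).2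
    -- Applying `Gᵀ` to the normal equation exhibits the would-be coordinates of `TPy` as those of
    -- `Gᵀ(x - y)`. They are therefore square summable, so `Py` lies in the domain even when `a` is
    -- unbounded.
    have hinv : ∀ i j, a j * ⟪e j, matAct (secondDiff m) y i⟫ =
        ⟪e j, matAct (pinv m).transpose (x - y) i⟫ := fun i j => by
      have h1 : matAct (secondDiff m).transpose
          (fun i => a j * matAct (secondDiff m) (w j) i) = fun i => ⟪e j, (x - y) i⟫ := by
        ext k
        have := congrFun (heq j) k
        simp only [Pi.add_apply, Pi.sub_apply, inner_sub_right, hy] at this ⊢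
        linarith
      have h2 := congrArg (matAct (pinv m).transpose) h1
      rw [← matAct_mul, pinv_transpose_mul_transpose, one_matAct] at h2
      rw [hPy, inner_matAct]
      exact congrFun h2 i
    have hdom : ∀ i, matAct (secondDiff m) y i ∈ (diagOp e a).domain := fun i => by
      rw [mem_diagOp_domain]
      simp only [hinv]
      exact summable_inner_sq e _
    refine ⟨y, hdom, ?_⟩
    ext k
    apply ext_inner_hilbertBasis e
    intro j
    have h1 := congrFun (heq j) k
    rw [← h1, Pi.add_apply, inner_add_right, inner_matAct, hy, Pi.add_apply]
    simp only [inner_diagOp, hPy]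

namespace IsDiagonalCovariance

variable {e} {S : H →L[ℝ] H} {s : ℕ → ℝ}

theorem inner_basis (hS : IsDiagonalCovariance e S s) (h : H) (j : ℕ) :
    ⟪e j, S h⟫ = s j * ⟪e j, h⟫ := inner_eq_of_hasSum e (hS.hasSum h) j

theorem inner_nonneg (hS : IsDiagonalCovariance e S s) (h : H) : 0 ≤ ⟪S h, h⟫ := by
  rw [← e.tsum_inner_mul_inner]
  refine tsum_nonneg fun j => ?_
  rw [real_inner_comm (e j), hS.inner_basis, mul_assoc]
  exact mul_nonneg (hS.pos j).le (mul_self_nonneg _)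

/-- By Parseval the form is a sum of the nonnegative terms `s j ⟨e j, h⟩²`, with `s j > 0`. -/
theorem eq_zero_of_inner_eq_zero (hS : IsDiagonalCovariance e S s) {h : H}
    (h0 : ⟪S h, h⟫ = 0) : h = 0 := by
  have hnn : ∀ j, 0 ≤ ⟪S h, e j⟫ * ⟪e j, h⟫ := fun j => by
    rw [real_inner_comm (e j), hS.inner_basis, mul_assoc]
    exact mul_nonneg (hS.pos j).le (mul_self_nonneg _)
  have hsum := e.hasSum_inner_mul_inner (S h) h
  rw [h0, hasSum_zero_iff_of_nonneg hnn] at hsum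
  apply ext_inner_hilbertBasis e
  intro j
  have := congrFun hsum j
  simp only [Pi.zero_apply] at this
  rw [real_inner_comm (e j), hS.inner_basis, mul_assoc] at this
  rw [inner_zero_right]
  simpa [(hS.pos j).ne'] using this

theorem injective (hS : IsDiagonalCovariance e S s) : Function.Injective S := by
  rw [injective_iff_map_eq_zero]
  intro h hh
  exact hS.eq_zero_of_inner_eq_zero (by rw [hh, inner_zero_left])

/-- The ratio of two diagonal covariance operators maps `Sv h` to `Su h`. -/
theorem diagOp_div {Su Sv : H →L[ℝ] H} {μ τ : ℕ → ℝ} (hSu : IsDiagonalCovariance e Su μ)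
    (hSv : IsDiagonalCovariance e Sv τ) (h : H) :
    ∃ hd : Sv h ∈ (diagOp e fun j => μ j / τ j).domain,
      diagOp e (fun j => μ j / τ j) ⟨Sv h, hd⟩ = Su h := by
  have hj : ∀ j, μ j / τ j * ⟪e j, Sv h⟫ = ⟪e j, Su h⟫ := fun j => by
    rw [hSv.inner_basis, hSu.inner_basis]
    field_simp [(hSv.pos j).ne']
  refine ⟨?_, ?_⟩
  · rw [mem_diagOp_domain]
    simp only [hj]
    exact summable_inner_sq e _
  · apply ext_inner_hilbertBasis e
    intro j
    rw [inner_diagOp]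
    exact hj j

end IsDiagonalCovariance

/-- The finite rank truncation `h ↦ ∑ j < N, a j ⟨h, e j⟩ e j` of a diagonal operator. -/
def truncOp (a : ℕ → ℝ) (N : ℕ) : H →L[ℝ] H :=
  ∑ j ∈ Finset.range N, (a j • innerSL ℝ (e j)).smulRight (e j)

theorem truncOp_apply (a : ℕ → ℝ) (N : ℕ) (h : H) :
    truncOp e a N h = ∑ j ∈ Finset.range N, (a j * ⟪e j, h⟫) • e j := by
  simp [truncOp]

theorem truncOp_symm (a : ℕ → ℝ) (N : ℕ) (g h : H) :
    ⟪truncOp e a N g, h⟫ = ⟪g, truncOp e a N h⟫ := by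
  simp only [truncOp_apply, sum_inner, inner_sum, real_inner_smul_left, real_inner_smul_right]
  refine Finset.sum_congr rfl fun j _ => ?_
  rw [real_inner_comm (e j) g]
  ring

theorem truncOp_mem_smoothingOps (ha : ∀ j, 0 ≤ a j) (N : ℕ) :
    truncOp e a N ∈ smoothingOps H := fun h => by
  rw [truncOp_apply, inner_sum]
  refine Finset.sum_nonneg fun j _ => ?_
  rw [real_inner_smul_right, real_inner_comm (e j), mul_assoc]
  exact mul_nonneg (ha j) (mul_self_nonneg _)

/-- A diagonal operator with bounded eigenvalues is bounded and everywhere defined. -/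
theorem exists_everywhere_eq_diagOp [CompleteSpace H] (ha : ∀ j, 0 ≤ a j)
    (hb : BddAbove (range a)) :
    ∃ B ∈ smoothingOps H, everywhere B = diagOp e a := by
  obtain ⟨C, hC⟩ := hb
  have hC' : ∀ j, a j ≤ C := fun j => hC ⟨j, rfl⟩
  have hle : ∀ (h : H) j, (a j * ⟪e j, h⟫) ^ 2 ≤ C ^ 2 * ⟪e j, h⟫ ^ 2 := fun h j => by
    rw [mul_pow]
    gcongr
    · exact ha j
    · exact hC' j
  have hdom : ∀ h, h ∈ (diagOp e a).domain := fun h =>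
    Summable.of_nonneg_of_le (fun j => sq_nonneg _) (hle h)
      ((summable_inner_sq e h).mul_left (C ^ 2))
  have htsum : ∀ h : H, ∑' j, ⟪e j, h⟫ ^ 2 = ‖h‖ ^ 2 := fun h => by
    rw [← real_inner_self_eq_norm_sq, ← e.tsum_inner_mul_inner]
    refine tsum_congr fun j => ?_
    rw [real_inner_comm (e j), sq]
  let f : H →ₗ[ℝ] H := (diagOp e a).toFun ∘ₗ LinearMap.codRestrict _ LinearMap.id hdom
  have hf : ∀ h, f h = diagOp e a ⟨h, hdom h⟩ := fun h => rfl
  let B : H →L[ℝ] H := f.mkContinuous C fun h => by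
    have hC0 : 0 ≤ C := (ha 0).trans (hC' 0)
    refine le_of_sq_le_sq ?_ (by positivity)
    rw [mul_pow, ← htsum, ← htsum h, ← tsum_mul_left]
    have hin : ∀ j, ⟪e j, f h⟫ ^ 2 = (a j * ⟪e j, h⟫) ^ 2 := fun j => by rw [hf, inner_diagOp]
    refine (summable_inner_sq e _).tsum_le_tsum (fun j => ?_)
      ((summable_inner_sq e h).mul_left (C ^ 2))
    rw [hin]
    exact hle h j
  refine ⟨B, fun h => diagOp_nonneg e ha ⟨h, hdom h⟩, ?_⟩
  refine LinearPMap.ext (Submodule.ext fun h => ⟨fun _ => hdom h, fun _ => Submodule.mem_top⟩) ?_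
  intro h _ _
  rfl

/-- Each eigenvalue is `⟨e j, B (e j)⟩`, hence at most `‖B‖`. -/
theorem bddAbove_of_everywhere_eq_diagOp {B : H →L[ℝ] H} (hB : everywhere B = diagOp e a) :
    BddAbove (range a) := by
  refine ⟨‖B‖, ?_⟩
  rintro _ ⟨j, rfl⟩
  have h1 : ∀ T : H →ₗ.[ℝ] H, everywhere B = T →
      ∃ hd : e j ∈ T.domain, T ⟨e j, hd⟩ = B (e j) := by
    rintro _ rfl
    exact ⟨mem_everywhere_domain B _, rfl⟩
  obtain ⟨hd, h2⟩ := h1 _ hB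
  have h3 := inner_diagOp e ⟨e j, hd⟩ j
  rw [h2, real_inner_self_eq_norm_sq, e.orthonormal.1 j, one_pow, mul_one] at h3
  rw [← h3]
  refine (real_inner_le_norm _ _).trans ?_
  rw [e.orthonormal.1 j, one_mul]
  simpa [e.orthonormal.1 j] using B.le_opNorm (e j)

end Diagonal

/-! ### Comparing the smoothers of two operators. -/

section Comparison

variable {H : Type*} [NormedAddCommGroup H] [InnerProductSpace ℝ H] {m : ℕ}

/-- The smoothers of the truncations of a diagonal operator converge strongly to its smoother. -/
theorem tendsto_pairing_smoother_truncOp (e : HilbertBasis ℕ ℝ H) {a : ℕ → ℝ}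
    (hT : IsAdmissible m (diagOp e a)) (hN : ∀ N, IsAdmissible m (everywhere (truncOp e a N)))
    (x : Fin (m + 2) → H) :
    Filter.Tendsto (fun N => pairing (hT.smoother x - (hN N).smoother x)
      (hT.smoother x - (hN N).smoother x)) Filter.atTop (nhds 0) := by
  obtain ⟨y, hy⟩ := hT.solvable x
  rw [hT.smoother_eq hy]
  obtain ⟨hy, hx⟩ := hy
  set w := fun i => diagOp e a ⟨matAct (secondDiff m) y i, hy i⟩
  let v : ℕ → Fin m → H := fun N i => truncOp e a N (matAct (secondDiff m) y i)
  have hle : ∀ N, pairing (y - (hN N).smoother x) (y - (hN N).smoother x) ≤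
      pairing (matAct (secondDiff m).transpose (v N - w))
        (matAct (secondDiff m).transpose (v N - w)) := fun N => by
    -- The limit `y` solves the truncated equation exactly, with `x` perturbed by `Pᵀ(v N - w)`.
    -- Nonexpansiveness bounds the error by this perturbation, which tends to zero because `Py` is
    -- in the domain.
    have h1 : SolvesNormalEq (everywhere (truncOp e a N))
        (y + matAct (secondDiff m).transpose (v N)) y :=
      ⟨fun i => mem_everywhere_domain _ _, rfl⟩
    have h2 := (h1.sub ((hN N).solves x)).pairing_self_le (hN N).nonneg
    rwa [← hx, add_sub_add_left_eq_sub, ← matAct_sub, hx] at h2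
  have hv : Filter.Tendsto (fun N => v N - w) Filter.atTop (nhds 0) := by
    rw [← sub_self w]
    refine Filter.Tendsto.sub_const (tendsto_pi_nhds.2 fun i => ?_) w
    simp only [v, truncOp_apply]
    exact (hasSum_diagOp e ⟨_, hy i⟩).tendsto_sum_nat
  have hcont : Continuous fun u : Fin m → H => pairing (matAct (secondDiff m).transpose u)
      (matAct (secondDiff m).transpose u) := by
    simp only [← matActCLM_apply, pairing_self]
    fun_prop
  have hlim := (hcont.tendsto 0).comp hv
  rw [matAct_zero, pairing_zero_right] at hlim
  exact squeeze_zero (fun N => pairing_self_nonneg _) hle hlim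

/-- An everywhere defined operator is determined by its smoother. -/
theorem everywhere_eq_of_smoother_eq (hm : 0 < m) {B : H →L[ℝ] H} {T : H →ₗ.[ℝ] H}
    (hB : IsAdmissible m (everywhere B)) (hT : IsAdmissible m T)
    (h : ∀ x, hT.smoother x = hB.smoother x) : everywhere B = T := by
  have key : ∀ g, ∃ hg : g ∈ T.domain, T ⟨g, hg⟩ = B g := fun g => by
    -- Since `P` is onto, any `g` is an entry of some `Py`, provided that there is at least one
    -- entry. Equal smoothers then give `PᵀTPy = PᵀBPy`, and `Gᵀ` cancels `Pᵀ`.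
    obtain ⟨y, hy⟩ : ∃ y : Fin (m + 2) → H, matAct (secondDiff m) y = fun _ => g :=
      ⟨matAct (pinv m) fun _ => g, by rw [← matAct_mul, secondDiff_mul_pinv, one_matAct]⟩
    have h1 : SolvesNormalEq (everywhere B)
        (y + matAct (secondDiff m).transpose fun i => B (matAct (secondDiff m) y i)) y :=
      ⟨fun i => mem_everywhere_domain _ _, rfl⟩
    have h2 := hT.solves
      (y + matAct (secondDiff m).transpose fun i => B (matAct (secondDiff m) y i))
    rw [← hT.smoother_apply, h, hB.smoother_eq h1] at h2
    obtain ⟨hd, h3⟩ := h2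
    have h4 := congrArg (matAct (pinv m).transpose) (add_left_cancel h3)
    rw [← matAct_mul, ← matAct_mul, pinv_transpose_mul_transpose, one_matAct, one_matAct] at h4
    have h5 := congrFun h4 ⟨0, hm⟩
    simp only [hy] at hd h5
    exact ⟨hd ⟨0, hm⟩, h5⟩
  refine LinearPMap.ext (Submodule.ext fun g => ⟨fun _ => (key g).1, fun _ => Submodule.mem_top⟩) ?_
  intro g _ _
  exact (key g).2.symm

/-- Decomposition of the error of a smoother into the parts orthogonal to and in the range
of `Pᵀ`. -/
theorem pairing_error_eq {T T' : H →ₗ.[ℝ] H} (hT : IsAdmissible m T) (hT' : IsAdmissible m T')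
    (y₀ x : Fin (m + 2) → H) (hy₀ : matAct (secondDiff m) y₀ = 0) :
    pairing (y₀ + matAct (rangeProj m) (hT.smoother x) - hT'.smoother x)
        (y₀ + matAct (rangeProj m) (hT.smoother x) - hT'.smoother x) =
      pairing (y₀ + matAct (rangeProj m) x - x) (y₀ + matAct (rangeProj m) x - x) +
        pairing (hT.smoother x - hT'.smoother x) (hT.smoother x - hT'.smoother x) := by
  have h1 := hT.sub_rangeProj_smoother x
  have h2 := hT'.sub_rangeProj_smoother x
  set d := hT.smoother x - hT'.smoother x with hd
  set c := y₀ + matAct (rangeProj m) x - x with hc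
  have e1 : y₀ + matAct (rangeProj m) (hT.smoother x) - hT'.smoother x = c + d := by
    rw [hc, hd]
    linear_combination (norm := module) (-1 : ℝ) • h1
  -- Orthogonality: `d` lies in the range of `Q` because both smoothers fix the complementary part
  -- of `x`, while `c` lies in the kernel of `Q` because `P y₀ = 0`.
  have hdP : matAct (rangeProj m) d = d := by
    rw [hd, matAct_sub]
    linear_combination (norm := module) (-1 : ℝ) • h1.trans h2.symm
  have hPc : matAct (rangeProj m) c = 0 := by
    rw [hc, matAct_sub, matAct_add, rangeProj, ← matAct_mul, Matrix.mul_assoc,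
      ← Matrix.mul_assoc (secondDiff m), secondDiff_mul_pinv, Matrix.one_mul, matAct_mul, hy₀,
      matAct_zero]
    abel
  have hcd : pairing c d = 0 := by
    rw [← hdP, ← rangeProj_transpose, ← pairing_matAct, hPc, pairing_comm, pairing_zero_right]
  rw [e1]
  simp only [pairing_add_left, pairing_add_right]
  rw [pairing_comm d c, hcd]
  ring

end Comparison

/-- The span of a countable basis is dense. Second countability is what measurability and Gaussian
laws on finite powers of `H` rest on. -/
theorem secondCountableTopology_of_hilbertBasis {H : Type*} [NormedAddCommGroup H]
    [InnerProductSpace ℝ H] (e : HilbertBasis ℕ ℝ H) : SecondCountableTopology H := by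
  have h1 : TopologicalSpace.IsSeparable
      ((Submodule.span ℝ (range e)).topologicalClosure : Set H) := by
    rw [Submodule.topologicalClosure_coe]
    exact ((countable_range e).isSeparable.span (R := ℝ)).closure
  rw [e.dense_span, Submodule.top_coe, TopologicalSpace.isSeparable_univ_iff] at h1
  exact UniformSpace.secondCountable_of_separable H

/-! ### Gaussian noise in `Hⁿ` and the covariances of its linear functionals. -/

section Pairing

variable {H : Type*} [NormedAddCommGroup H] [InnerProductSpace ℝ H]

/-- Pairing with a fixed vector, as a continuous linear functional. -/
def pairingCLM {ι : Type*} [Fintype ι] (a : ι → H) : (ι → H) →L[ℝ] ℝ :=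
  ∑ i, innerSL ℝ (a i) ∘L ContinuousLinearMap.proj i

theorem pairingCLM_apply {ι : Type*} [Fintype ι] (a x : ι → H) :
    pairingCLM a x = pairing a x := by
  simp [pairingCLM, pairing]

end Pairing

section Noise

variable {H : Type*} [NormedAddCommGroup H] [InnerProductSpace ℝ H] [MeasurableSpace H]
  [BorelSpace H] {Ω : Type*} [MeasurableSpace Ω] {P : Measure Ω} {k : ℕ}

namespace IsGaussianNoise

variable {W : Fin k → Ω → H} {S : H →L[ℝ] H}

theorem memLp_inner (hW : IsGaussianNoise P W S) (i : Fin k) (g : H) :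
    MemLp (fun ω => ⟪g, W i ω⟫) 2 P :=
  ((hW.gaussian i).map_fun (innerSL ℝ g)).memLp_two

variable [CompleteSpace H] [SecondCountableTopology H]

theorem hasGaussianLaw (hW : IsGaussianNoise P W S) : HasGaussianLaw (fun ω i => W i ω) P :=
  hW.indep.hasGaussianLaw hW.gaussian

theorem integral_eq_zero (hW : IsGaussianNoise P W S) : ∫ ω, (fun i => W i ω) ∂P = 0 := by
  ext i
  rw [eval_integral fun i => (hW.gaussian i).integrable]
  exact hW.mean_zero i

theorem memLp_pairing (hW : IsGaussianNoise P W S) (a : Fin k → H) :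
    MemLp (fun ω => pairing a fun i => W i ω) 2 P := by
  simp only [← pairingCLM_apply]
  exact (hW.hasGaussianLaw.map_fun (pairingCLM a)).memLp_two

theorem covariance_inner (hW : IsGaussianNoise P W S) (i j : Fin k) (g h : H) :
    cov[fun ω => ⟪g, W i ω⟫, fun ω => ⟪h, W j ω⟫; P] = if i = j then ⟪S g, h⟫ else 0 := by
  have := (hW.gaussian i).isProbabilityMeasure
  split_ifs with hij
  · subst hij
    rw [covariance_eq_sub (hW.memLp_inner i g) (hW.memLp_inner i h)]
    have h0 : ∫ ω, ⟪g, W i ω⟫ ∂P = 0 := by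
      rw [integral_inner (hW.gaussian i).integrable, hW.mean_zero, inner_zero_right]
    rw [h0, zero_mul, sub_zero, ← hW.covariance i g h]
    simp only [Pi.mul_apply, real_inner_comm (W i _)]
  · exact ((hW.indep.indepFun hij).comp (φ := fun x => ⟪g, x⟫) (ψ := fun x => ⟪h, x⟫)
      (by fun_prop) (by fun_prop)).covariance_eq_zero (hW.memLp_inner i g) (hW.memLp_inner j h)

theorem covariance_pairing (hW : IsGaussianNoise P W S) (a b : Fin k → H) :
    cov[fun ω => pairing a fun i => W i ω, fun ω => pairing b fun i => W i ω; P] =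
      pairing a fun i => S (b i) := by
  -- An empty family does not force `P` to be a probability measure, so it is treated apart.
  rcases Nat.eq_zero_or_pos k with rfl | hk
  · simp only [pairing, Finset.univ_eq_empty, Finset.sum_empty]
    exact covariance_zero_left
  have := (hW.gaussian ⟨0, hk⟩).isProbabilityMeasure
  simp only [pairing]
  rw [covariance_fun_sum_fun_sum (fun i => hW.memLp_inner i (a i))
    fun i => hW.memLp_inner i (b i)]
  refine Finset.sum_congr rfl fun i _ => ?_
  simp only [hW.covariance_inner, Finset.sum_ite_eq, Finset.mem_univ, if_true]
  rw [← hW.covariance i, real_inner_comm, ← hW.covariance i]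
  simp only [mul_comm]

end IsGaussianNoise

variable [CompleteSpace H] [SecondCountableTopology H] {l : ℕ} {U : Fin k → Ω → H}
  {V : Fin l → Ω → H} {Su Sv : H →L[ℝ] H}

/-- Independence of `U` and `V` removes the two mixed covariances. -/
theorem covariance_pairing_add_pairing (hU : IsGaussianNoise P U Su)
    (hV : IsGaussianNoise P V Sv) (hUV : IndepFun (fun ω i => U i ω) (fun ω i => V i ω) P)
    [IsProbabilityMeasure P] (a b : Fin k → H) (c d : Fin l → H) :
    cov[fun ω => pairing a (fun i => U i ω) + pairing c (fun i => V i ω),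
      fun ω => pairing b (fun i => U i ω) + pairing d (fun i => V i ω); P] =
      pairing a (fun i => Su (b i)) + pairing c (fun i => Sv (d i)) := by
  have hind : ∀ a' d', cov[fun ω => pairing a' fun i => U i ω,
      fun ω => pairing d' fun i => V i ω; P] = 0 := fun a' d' => by
    have h := hUV.comp (φ := pairingCLM a') (ψ := pairingCLM d') (by fun_prop) (by fun_prop)
    have := h.covariance_eq_zero (hU.hasGaussianLaw.map (pairingCLM a')).memLp_two
      (hV.hasGaussianLaw.map (pairingCLM d')).memLp_two
    simpa only [Function.comp_def, pairingCLM_apply] using this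
  have hb := hU.memLp_pairing b
  have hd := hV.memLp_pairing d
  have h1 := covariance_add_left (hU.memLp_pairing a) (hV.memLp_pairing c) (hb.add hd)
  rw [covariance_add_right (hU.memLp_pairing a) hb hd,
    covariance_add_right (hV.memLp_pairing c) hb hd, hind,
    covariance_comm (fun ω => pairing c fun i => V i ω) fun ω => pairing b fun i => U i ω, hind,
    hU.covariance_pairing, hV.covariance_pairing, add_zero, zero_add] at h1
  exact h1

end Noise

/-! ### The conditional expectation of the signal given the observation. -/

section Signal

variable {H : Type*} [NormedAddCommGroup H] [InnerProductSpace ℝ H] [MeasurableSpace H]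
  [BorelSpace H] [SecondCountableTopology H] {Ω : Type*} [MeasurableSpace Ω] {P : Measure Ω}
  {m : ℕ} {U : Fin (m + 2) → Ω → H} {V : Fin m → Ω → H} {Su Sv : H →L[ℝ] H} {T : H →ₗ.[ℝ] H}

theorem measurable_observation (hU : IsGaussianNoise P U Su) (hV : IsGaussianNoise P V Sv)
    (Y₀ : Fin (m + 2) → H) : Measurable (observation Y₀ U V) := by
  have h1 : Measurable fun ω i => V i ω := measurable_pi_lambda _ hV.measurable
  have h2 : Measurable fun ω i => U i ω := measurable_pi_lambda _ hU.measurable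
  exact (measurable_const.add ((matActCLM (pinv m)).continuous.measurable.comp h1)).add h2

variable [CompleteSpace H] [IsProbabilityMeasure P]

theorem memLp_signal (hV : IsGaussianNoise P V Sv) (Y₀ : Fin (m + 2) → H) :
    MemLp (signal Y₀ V) 2 P :=
  (memLp_const Y₀).add (hV.hasGaussianLaw.map_fun (matActCLM (pinv m))).memLp_two

theorem memLp_observation (hU : IsGaussianNoise P U Su) (hV : IsGaussianNoise P V Sv)
    (Y₀ : Fin (m + 2) → H) : MemLp (observation Y₀ U V) 2 P :=
  (memLp_signal hV Y₀).add hU.hasGaussianLaw.memLp_two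

/-- The difference between the signal and its best prediction is uncorrelated with the
observation, hence independent of it. -/
theorem indepFun_residual (hU : IsGaussianNoise P U Su) (hV : IsGaussianNoise P V Sv)
    (hUV : IndepFun (fun ω i => U i ω) (fun ω i => V i ω) P) (hT : IsAdmissible m T)
    (hratio : ∀ h, ∃ hd : Sv h ∈ T.domain, T ⟨Sv h, hd⟩ = Su h) :
    IndepFun (signal 0 V - fun ω => matAct (rangeProj m) (hT.smoother (observation 0 U V ω)))
      (observation 0 U V) P := by
  let G : (Fin m → H) →L[ℝ] (Fin (m + 2) → H) := matActCLM (pinv m)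
  let X' : ((Fin (m + 2) → H) × (Fin m → H)) →L[ℝ] (Fin (m + 2) → H) :=
    G ∘L ContinuousLinearMap.snd ℝ _ _ + ContinuousLinearMap.fst ℝ _ _
  let R : ((Fin (m + 2) → H) × (Fin m → H)) →L[ℝ] (Fin (m + 2) → H) :=
    G ∘L ContinuousLinearMap.snd ℝ _ _ - matActCLM (rangeProj m) ∘L hT.smoother ∘L X'
  have hX' : ∀ ω, observation 0 U V ω = X' (fun i => U i ω, fun i => V i ω) := fun ω => by
    simp [observation, signal, X', G, matActCLM_apply, pinv]
  have hR : ∀ ω, (signal 0 V - fun ω =>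
      matAct (rangeProj m) (hT.smoother (observation 0 U V ω))) ω =
      R (fun i => U i ω, fun i => V i ω) := fun ω => by
    rw [Pi.sub_apply, hX']
    simp [signal, R, G, matActCLM_apply, pinv]
  -- Residual and observation are linear images of the Gaussian pair `(U, V)`, hence jointly
  -- Gaussian; it suffices that all covariances of their functionals vanish.
  have hlaw := (hUV.hasGaussianLaw hU.hasGaussianLaw hV.hasGaussianLaw).map_fun (R.prod X')
  rw [funext hR, funext hX']
  refine HasGaussianLaw.indepFun_of_covariance_strongDual hlaw fun f g => ?_
  obtain ⟨a, ha⟩ := exists_pairing_eq f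
  obtain ⟨b, hb⟩ := exists_pairing_eq g
  set Q := rangeProj m
  -- As `Q` and the smoother are self-adjoint, `⟨a, Q S x⟩ = ⟨c, x⟩`.
  set c := hT.smoother (matAct Q a) with hc
  have hXb : ∀ u v, g (X' (u, v)) = pairing b u + pairing (matAct (pinv m).transpose b) v :=
    fun u v => by
      simp only [hb, X', G, add_apply, ContinuousLinearMap.comp_apply,
        ContinuousLinearMap.coe_fst', ContinuousLinearMap.coe_snd', matActCLM_apply,
        pairing_add_right]
      rw [pairing_comm _ (matAct (pinv m) v), pairing_matAct, pairing_comm v, add_comm]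
  have hRa : ∀ u v, f (R (u, v)) =
      pairing (-c) u + pairing (matAct (pinv m).transpose (a - c)) v := fun u v => by
    simp only [ha, R, X', G, sub_apply, add_apply, ContinuousLinearMap.comp_apply,
      ContinuousLinearMap.coe_fst', ContinuousLinearMap.coe_snd', matActCLM_apply,
      pairing_sub_right]
    rw [pairing_comm a (matAct Q _), pairing_matAct, rangeProj_transpose, hT.pairing_smoother,
      ← hc, pairing_add_left, pairing_comm a, pairing_matAct, pairing_matAct, pairing_comm v,
      pairing_comm v, matAct_sub, pairing_sub_left, ← zero_sub, pairing_sub_left,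
      pairing_comm 0, pairing_zero_right, pairing_comm u]
    ring
  have hcov := covariance_pairing_add_pairing hU hV hUV (-c) b
    (matAct (pinv m).transpose (a - c)) (matAct (pinv m).transpose b)
  have e1 : (f ∘ fun ω => R (fun i => U i ω, fun i => V i ω)) = fun ω =>
      pairing (-c) (fun i => U i ω) +
        pairing (matAct (pinv m).transpose (a - c)) fun i => V i ω := funext fun ω => hRa _ _
  have e2 : (g ∘ fun ω => X' (fun i => U i ω, fun i => V i ω)) = fun ω =>
      pairing b (fun i => U i ω) +
        pairing (matAct (pinv m).transpose b) fun i => V i ω := funext fun ω => hXb _ _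
  rw [e1, e2, hcov]
  -- The decisive vector: `T` turns `Py = Sv Gᵀ b` into `Su Gᵀ b`, and `PᵀGᵀ = Q`, so `y` is the
  -- smoothed version of `y + Q Su b`.
  set y := matAct (pinv m) (fun i => Sv (matAct (pinv m).transpose b i)) with hy
  have hPy : matAct (secondDiff m) y = fun i => Sv (matAct (pinv m).transpose b i) := by
    rw [hy, ← matAct_mul, secondDiff_mul_pinv, one_matAct]
  have hsol : SolvesNormalEq T (y + matAct Q fun i => Su (b i)) y := by
    refine ⟨fun i => ?_, ?_⟩
    · rw [hPy]
      exact (hratio _).1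
    · congr 1
      simp only [hPy, (hratio _).2]
      rw [show (fun i => Su (matAct (pinv m).transpose b i)) =
        matAct (pinv m).transpose fun i => Su (b i) from
          funext fun i => (matAct_map _ Su b i).symm, ← matAct_mul, transpose_mul_pinv_transpose]
  have hQy : matAct Q y = y := by
    rw [hy, ← matAct_mul, rangeProj_mul_pinv]
  -- The covariance is `⟨a - c, y⟩ - ⟨c, Su b⟩`, so this identity is its vanishing.
  have hfin : pairing c (y + fun i => Su (b i)) = pairing a y := by
    rw [hc, hT.pairing_smoother, pairing_matAct, rangeProj_transpose, ← hT.smoother_rangeProj,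
      matAct_add, hQy, hT.smoother_eq hsol]
  have hfirst : pairing (matAct (pinv m).transpose (a - c))
      (fun i => Sv (matAct (pinv m).transpose b i)) = pairing (a - c) y := by
    rw [pairing_matAct, Matrix.transpose_transpose]
  rw [hfirst, pairing_sub_left, ← hfin, pairing_add_right, ← zero_sub, pairing_sub_left,
    pairing_comm 0, pairing_zero_right]
  ring

/-- The conditional expectation of the signal, given the observation. -/
theorem condExp_signal (hU : IsGaussianNoise P U Su) (hV : IsGaussianNoise P V Sv)
    (hUV : IndepFun (fun ω i => U i ω) (fun ω i => V i ω) P) (hT : IsAdmissible m T)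
    (hratio : ∀ h, ∃ hd : Sv h ∈ T.domain, T ⟨Sv h, hd⟩ = Su h) {Y₀ : Fin (m + 2) → H}
    (hY₀ : matAct (secondDiff m) Y₀ = 0) :
    P[signal Y₀ V | MeasurableSpace.comap (observation Y₀ U V) inferInstance] =ᵐ[P]
      fun ω => Y₀ + matAct (rangeProj m) (hT.smoother (observation Y₀ U V ω)) := by
  set X := observation Y₀ U V with hX
  set R := signal 0 V - fun ω => matAct (rangeProj m) (hT.smoother (observation 0 U V ω)) with hR
  set M := fun ω => Y₀ + matAct (rangeProj m) (hT.smoother (X ω)) with hM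
  have hXm : Measurable X := measurable_observation hU hV Y₀
  have hX0 : ∀ ω, X ω = Y₀ + observation 0 U V ω := fun ω => by
    simp [hX, observation, signal, add_assoc]
  -- The trend is invisible to the prediction of the fluctuation, which allows passing to the
  -- centred case.
  have hproj : matAct (rangeProj m) (hT.smoother Y₀) = 0 := by
    rw [← hT.smoother_rangeProj, rangeProj, matAct_mul, hY₀, matAct_zero, map_zero]
  have hdecomp : signal Y₀ V = M + R := by
    ext1 ω
    rw [Pi.add_apply, hM, hR, Pi.sub_apply]
    simp only [hX0, map_add, matAct_add, hproj]
    simp [signal]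
  have hlin : Continuous fun x : Fin (m + 2) → H => matAct (rangeProj m) (hT.smoother x) :=
    (matActCLM (rangeProj m) ∘L hT.smoother).continuous
  have hlinLp : ∀ Z : Ω → Fin (m + 2) → H, MemLp Z 2 P →
      MemLp (fun ω => matAct (rangeProj m) (hT.smoother (Z ω))) 2 P := fun Z hZ =>
    (matActCLM (rangeProj m) ∘L hT.smoother).comp_memLp' hZ
  have hMint : Integrable M P :=
    ((memLp_const Y₀).add (hlinLp X (memLp_observation hU hV Y₀))).integrable (by norm_num)
  have hRint : Integrable R P :=
    ((memLp_signal hV 0).sub (hlinLp _ (memLp_observation hU hV 0))).integrable (by norm_num)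
  have hRmeas : Measurable R := by
    have h1 : Measurable fun ω i => V i ω := measurable_pi_lambda _ hV.measurable
    exact (measurable_const.add ((matActCLM (pinv m)).continuous.measurable.comp h1)).sub
      (hlin.measurable.comp (measurable_observation hU hV 0))
  have hindep : IndepFun R X P := by
    have h := (indepFun_residual hU hV hUV hT hratio).comp (φ := id) (ψ := fun x => Y₀ + x)
      measurable_id (by fun_prop)
    have hXe : X = (fun x => Y₀ + x) ∘ observation 0 U V := funext hX0
    rw [hXe]
    exact h
  have hsig0 : ∫ ω, signal 0 V ω ∂P = 0 := by
    have := (matActCLM (pinv m) : (Fin m → H) →L[ℝ] _).integral_comp_comm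
      hV.hasGaussianLaw.integrable
    rw [hV.integral_eq_zero, map_zero] at this
    simpa [signal, matActCLM_apply, pinv] using this
  have hobs0 : ∫ ω, observation 0 U V ω ∂P = 0 := by
    have := integral_add ((memLp_signal hV 0).integrable (by norm_num))
      hU.hasGaussianLaw.integrable
    rwa [hsig0, hU.integral_eq_zero, add_zero] at this
  have hRmean : ∫ ω, R ω ∂P = 0 := by
    have h1 := (matActCLM (rangeProj m) ∘L hT.smoother).integral_comp_comm
      ((memLp_observation hU hV 0).integrable (by norm_num))
    rw [hobs0, map_zero] at h1
    have h2 := integral_sub ((memLp_signal hV (0 : Fin (m + 2) → H)).integrable (by norm_num))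
      ((hlinLp _ (memLp_observation hU hV 0)).integrable (by norm_num))
    rw [hsig0, zero_sub] at h2
    exact h2.trans (by rw [neg_eq_zero]; exact h1)
  have hM' : StronglyMeasurable[MeasurableSpace.comap X inferInstance] M := by
    apply Measurable.stronglyMeasurable
    exact ((continuous_const.add hlin).measurable).comp (comap_measurable X)
  have h1 := condExp_add hMint hRint (MeasurableSpace.comap X inferInstance)
  have h2 := condExp_indep_eq hRmeas.comap_le hXm.comap_le
    (comap_measurable R).stronglyMeasurable hindep
  rw [hRmean] at h2
  rw [hdecomp]
  filter_upwards [h1, h2] with ω h1 h2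
  rw [h1, Pi.add_apply, h2, add_zero, condExp_of_stronglyMeasurable hXm.comap_le hM' hMint]

/-- A symmetric continuous linear map that vanishes almost surely at the observation is zero. -/
theorem eq_zero_of_ae_observation_eq_zero {e : HilbertBasis ℕ ℝ H} {μ τ : ℕ → ℝ}
    (hSu : IsDiagonalCovariance e Su μ) (hSv : IsDiagonalCovariance e Sv τ)
    (hU : IsGaussianNoise P U Su) (hV : IsGaussianNoise P V Sv)
    (hUV : IndepFun (fun ω i => U i ω) (fun ω i => V i ω) P) (Y₀ : Fin (m + 2) → H)
    {D : (Fin (m + 2) → H) → (Fin (m + 2) → H)}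
    (hD : ∀ x z, pairing (D x) z = pairing x (D z))
    (h0 : ∀ᵐ ω ∂P, D (observation Y₀ U V ω) = 0) (x : Fin (m + 2) → H) : D x = 0 := by
  -- By symmetry `⟨b, X⟩ = ⟨x, D X⟩` vanishes almost surely. Its fluctuating part thus has zero
  -- variance `⟨b, Su b⟩ + ⟨c, Sv c⟩`; both terms are nonnegative, and `Su` is positive definite.
  set b := D x with hb
  set c := matAct (pinv m).transpose b
  have hae : (fun ω => pairing b (fun i => U i ω) + pairing c fun i => V i ω) =ᵐ[P]
      fun _ => - pairing b Y₀ := by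
    filter_upwards [h0] with ω hω
    have h1 : pairing b (observation Y₀ U V ω) = 0 := by
      rw [hb, hD, hω, pairing_zero_right]
    simp only [observation, signal, pairing_add_right] at h1
    rw [pairing_comm b (matAct _ _), show (secondDiff m).transpose *
      (secondDiff m * (secondDiff m).transpose)⁻¹ = pinv m from rfl, pairing_matAct,
      pairing_comm _ (matAct _ _)] at h1
    linarith
  have hcov := covariance_pairing_add_pairing hU hV hUV b b c c
  have hzero : cov[fun ω => pairing b (fun i => U i ω) + pairing c fun i => V i ω,
      fun ω => pairing b (fun i => U i ω) + pairing c fun i => V i ω; P] = 0 := by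
    rw [covariance, integral_congr_ae hae]
    refine integral_eq_zero_of_ae ?_
    filter_upwards [hae] with ω hω
    simp [hω]
  rw [hzero] at hcov
  have h1 : 0 ≤ pairing c fun i => Sv (c i) := Finset.sum_nonneg fun i _ => by
    rw [real_inner_comm]
    exact hSv.inner_nonneg _
  have h2 : ∀ i, 0 ≤ ⟪b i, Su (b i)⟫ := fun i => by
    rw [real_inner_comm]
    exact hSu.inner_nonneg _
  have h3 : pairing b (fun i => Su (b i)) = 0 :=
    le_antisymm (by linarith) (Finset.sum_nonneg fun i _ => h2 i)
  rw [pairing, Finset.sum_eq_zero_iff_of_nonneg fun i _ => h2 i] at h3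
  ext i
  refine hSu.eq_zero_of_inner_eq_zero ?_
  rw [real_inner_comm]
  exact h3 i (Finset.mem_univ i)

end Signal

/-! ### The distance between two smoothed observations. -/

section Gap

variable {H : Type*} [NormedAddCommGroup H] [InnerProductSpace ℝ H] {m : ℕ}
  {T T' : H →ₗ.[ℝ] H}

theorem integrable_pairing_self {ι Ω : Type*} [Fintype ι] [MeasurableSpace Ω]
    {P : Measure Ω} {Z : Ω → ι → H} (hZ : MemLp Z 2 P) :
    Integrable (fun ω => pairing (Z ω) (Z ω)) P := by
  simp only [pairing_self]
  exact integrable_finsetSum _ fun i _ =>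
    ((ContinuousLinearMap.proj (R := ℝ) (φ := fun _ : ι => H) i).comp_memLp' hZ).norm.integrable_sq

/-- The squared distance between two smoothed observations. -/
def gap (hT : IsAdmissible m T) (hT' : IsAdmissible m T') (x : Fin (m + 2) → H) : ℝ :=
  pairing (hT.smoother x - hT'.smoother x) (hT.smoother x - hT'.smoother x)

/-- The squared norm of the part of `x - y₀` orthogonal to the range of `Pᵀ`. -/
def baseLoss (y₀ x : Fin (m + 2) → H) : ℝ :=
  pairing (y₀ + matAct (rangeProj m) x - x) (y₀ + matAct (rangeProj m) x - x)

theorem gap_nonneg (hT : IsAdmissible m T) (hT' : IsAdmissible m T') (x : Fin (m + 2) → H) :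
    0 ≤ gap hT hT' x := pairing_self_nonneg _

theorem gap_self (hT : IsAdmissible m T) (x : Fin (m + 2) → H) : gap hT hT x = 0 := by
  rw [gap, sub_self, pairing_zero_right]

/-- From `‖u - v‖² ≤ 2‖u‖² + 2‖v‖²` and nonexpansiveness. It is the dominating function, uniform in
the operator, for the passage to the limit along truncations. -/
theorem gap_le (hT : IsAdmissible m T) (hT' : IsAdmissible m T') (x : Fin (m + 2) → H) :
    gap hT hT' x ≤ 4 * pairing x x := by
  have h1 := (hT.solves x).pairing_self_le hT.nonneg
  have h2 := (hT'.solves x).pairing_self_le hT'.nonneg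
  rw [← hT.smoother_apply] at h1
  rw [← hT'.smoother_apply] at h2
  have h3 := pairing_self_nonneg (hT.smoother x + hT'.smoother x)
  rw [gap]
  simp only [pairing_add_left, pairing_add_right, pairing_sub_left, pairing_sub_right] at h3 ⊢
  linarith

end Gap

/-! ### The loss, its mean, and its minimization. -/

section Loss

variable {H : Type*} [NormedAddCommGroup H] [InnerProductSpace ℝ H] [CompleteSpace H]
  [MeasurableSpace H] {Ω : Type*} [MeasurableSpace Ω] {P : Measure Ω} {m : ℕ}

theorem loss_symmPart (X Y : Ω → Fin (m + 2) → H) (B : H →L[ℝ] H) :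
    loss P X Y (everywhere (symmPart B)) = loss P X Y (everywhere B) := by
  ext ω
  simp only [loss, smoothSignal_symmPart]

theorem meanLoss_symmPart (X Y : Ω → Fin (m + 2) → H) (B : H →L[ℝ] H) :
    meanLoss P X Y (everywhere (symmPart B)) = meanLoss P X Y (everywhere B) := by
  rw [meanLoss, loss_symmPart, meanLoss]

variable [BorelSpace H] [SecondCountableTopology H] [IsProbabilityMeasure P]
  {U : Fin (m + 2) → Ω → H} {V : Fin m → Ω → H} {Su Sv : H →L[ℝ] H} {T T' : H →ₗ.[ℝ] H}

/-- The exceptional null set comes only from the chosen version of `E[Y|X]`, which does not involve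
`T'`; hence the uncountably many operators are handled simultaneously. -/
theorem ae_loss_eq (hU : IsGaussianNoise P U Su) (hV : IsGaussianNoise P V Sv)
    (hUV : IndepFun (fun ω i => U i ω) (fun ω i => V i ω) P) (hT : IsAdmissible m T)
    (hratio : ∀ h, ∃ hd : Sv h ∈ T.domain, T ⟨Sv h, hd⟩ = Su h) {Y₀ : Fin (m + 2) → H}
    (hY₀ : matAct (secondDiff m) Y₀ = 0) :
    ∀ᵐ ω ∂P, ∀ (T' : H →ₗ.[ℝ] H) (hT' : IsAdmissible m T'),
      loss P (observation Y₀ U V) (signal Y₀ V) T' ω =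
        baseLoss Y₀ (observation Y₀ U V ω) + gap hT hT' (observation Y₀ U V ω) := by
  filter_upwards [condExp_signal hU hV hUV hT hratio hY₀] with ω hω T' hT'
  rw [baseLoss, gap, ← pairing_error_eq hT hT' _ _ hY₀, pairing_self, loss, hω]
  rfl

theorem integrable_baseLoss (hU : IsGaussianNoise P U Su) (hV : IsGaussianNoise P V Sv)
    (Y₀ : Fin (m + 2) → H) : Integrable (fun ω => baseLoss Y₀ (observation Y₀ U V ω)) P := by
  have hX := memLp_observation hU hV Y₀
  exact integrable_pairing_self
    (((memLp_const Y₀).add ((matActCLM (H := H) (rangeProj m)).comp_memLp' hX)).sub hX)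

theorem integrable_gap (hU : IsGaussianNoise P U Su) (hV : IsGaussianNoise P V Sv)
    (Y₀ : Fin (m + 2) → H) (hT : IsAdmissible m T) (hT' : IsAdmissible m T') :
    Integrable (fun ω => gap hT hT' (observation Y₀ U V ω)) P :=
  integrable_pairing_self ((hT.smoother - hT'.smoother).comp_memLp' (memLp_observation hU hV Y₀))

theorem integrable_loss (hU : IsGaussianNoise P U Su) (hV : IsGaussianNoise P V Sv)
    (hUV : IndepFun (fun ω i => U i ω) (fun ω i => V i ω) P) (hT : IsAdmissible m T)
    (hratio : ∀ h, ∃ hd : Sv h ∈ T.domain, T ⟨Sv h, hd⟩ = Su h) {Y₀ : Fin (m + 2) → H}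
    (hY₀ : matAct (secondDiff m) Y₀ = 0) (hT' : IsAdmissible m T') :
    Integrable (loss P (observation Y₀ U V) (signal Y₀ V) T') P := by
  refine ((integrable_baseLoss hU hV Y₀).add (integrable_gap hU hV Y₀ hT hT')).congr ?_
  filter_upwards [ae_loss_eq hU hV hUV hT hratio hY₀] with ω hω
  exact (hω T' hT').symm

theorem meanLoss_eq (hU : IsGaussianNoise P U Su) (hV : IsGaussianNoise P V Sv)
    (hUV : IndepFun (fun ω i => U i ω) (fun ω i => V i ω) P) (hT : IsAdmissible m T)
    (hratio : ∀ h, ∃ hd : Sv h ∈ T.domain, T ⟨Sv h, hd⟩ = Su h) {Y₀ : Fin (m + 2) → H}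
    (hY₀ : matAct (secondDiff m) Y₀ = 0) (hT' : IsAdmissible m T') :
    meanLoss P (observation Y₀ U V) (signal Y₀ V) T' =
      meanLoss P (observation Y₀ U V) (signal Y₀ V) T +
        ∫ ω, gap hT hT' (observation Y₀ U V ω) ∂P := by
  have hb := integrable_baseLoss hU hV Y₀
  have hg := integrable_gap hU hV Y₀ hT hT'
  have h1 : meanLoss P (observation Y₀ U V) (signal Y₀ V) T =
      ∫ ω, baseLoss Y₀ (observation Y₀ U V ω) ∂P := by
    refine integral_congr_ae ?_
    filter_upwards [ae_loss_eq hU hV hUV hT hratio hY₀] with ω hω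
    rw [hω T hT, gap_self, add_zero]
  rw [h1, ← integral_add hb hg]
  refine integral_congr_ae ?_
  filter_upwards [ae_loss_eq hU hV hUV hT hratio hY₀] with ω hω
  exact hω T' hT'

theorem meanLoss_le (hU : IsGaussianNoise P U Su) (hV : IsGaussianNoise P V Sv)
    (hUV : IndepFun (fun ω i => U i ω) (fun ω i => V i ω) P) (hT : IsAdmissible m T)
    (hratio : ∀ h, ∃ hd : Sv h ∈ T.domain, T ⟨Sv h, hd⟩ = Su h) {Y₀ : Fin (m + 2) → H}
    (hY₀ : matAct (secondDiff m) Y₀ = 0) (hT' : IsAdmissible m T') :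
    meanLoss P (observation Y₀ U V) (signal Y₀ V) T ≤
      meanLoss P (observation Y₀ U V) (signal Y₀ V) T' := by
  rw [meanLoss_eq hU hV hUV hT hratio hY₀ hT']
  exact le_add_of_nonneg_right (integral_nonneg fun ω => gap_nonneg _ _ _)

theorem meanLoss_le_everywhere (hU : IsGaussianNoise P U Su) (hV : IsGaussianNoise P V Sv)
    (hUV : IndepFun (fun ω i => U i ω) (fun ω i => V i ω) P) (hT : IsAdmissible m T)
    (hratio : ∀ h, ∃ hd : Sv h ∈ T.domain, T ⟨Sv h, hd⟩ = Su h) {Y₀ : Fin (m + 2) → H}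
    (hY₀ : matAct (secondDiff m) Y₀ = 0) {B : H →L[ℝ] H} (hB : B ∈ smoothingOps H) :
    meanLoss P (observation Y₀ U V) (signal Y₀ V) T ≤
      meanLoss P (observation Y₀ U V) (signal Y₀ V) (everywhere B) := by
  rw [← meanLoss_symmPart]
  exact meanLoss_le hU hV hUV hT hratio hY₀ (isAdmissible_symmPart m hB)

/-- The mean losses of the truncations of a diagonal operator converge to its mean loss. -/
theorem tendsto_meanLoss_truncOp {e : HilbertBasis ℕ ℝ H} {a : ℕ → ℝ}
    (hU : IsGaussianNoise P U Su) (hV : IsGaussianNoise P V Sv)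
    (hUV : IndepFun (fun ω i => U i ω) (fun ω i => V i ω) P) (hT : IsAdmissible m (diagOp e a))
    (hratio : ∀ h, ∃ hd : Sv h ∈ (diagOp e a).domain, diagOp e a ⟨Sv h, hd⟩ = Su h)
    {Y₀ : Fin (m + 2) → H} (hY₀ : matAct (secondDiff m) Y₀ = 0)
    (hN : ∀ N, IsAdmissible m (everywhere (truncOp e a N))) :
    Filter.Tendsto
      (fun N => meanLoss P (observation Y₀ U V) (signal Y₀ V) (everywhere (truncOp e a N)))
      Filter.atTop (nhds (meanLoss P (observation Y₀ U V) (signal Y₀ V) (diagOp e a))) := by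
  simp only [fun N => meanLoss_eq hU hV hUV hT hratio hY₀ (hN N)]
  have h : Filter.Tendsto (fun N => ∫ ω, gap hT (hN N) (observation Y₀ U V ω) ∂P)
      Filter.atTop (nhds (∫ _, (0 : ℝ) ∂P)) := by
    refine tendsto_integral_of_dominated_convergence
      (fun ω => 4 * pairing (observation Y₀ U V ω) (observation Y₀ U V ω))
      (fun N => (integrable_gap hU hV Y₀ hT (hN N)).aestronglyMeasurable)
      ((integrable_pairing_self (memLp_observation hU hV Y₀)).const_mul 4)
      (fun N => ae_of_all _ fun ω => ?_)
      (ae_of_all _ fun ω => tendsto_pairing_smoother_truncOp e hT hN _)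
    rw [Real.norm_of_nonneg (gap_nonneg _ _ _)]
    exact gap_le _ _ _
  simpa using h.const_add (meanLoss P (observation Y₀ U V) (signal Y₀ V) (diagOp e a))

/-- The optimal operator is the only symmetric one that attains the minimal mean loss. -/
theorem meanLoss_lt {e : HilbertBasis ℕ ℝ H} {μ τ : ℕ → ℝ}
    (hSu : IsDiagonalCovariance e Su μ) (hSv : IsDiagonalCovariance e Sv τ)
    (hU : IsGaussianNoise P U Su) (hV : IsGaussianNoise P V Sv)
    (hUV : IndepFun (fun ω i => U i ω) (fun ω i => V i ω) P) (hT : IsAdmissible m T)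
    (hratio : ∀ h, ∃ hd : Sv h ∈ T.domain, T ⟨Sv h, hd⟩ = Su h)
    {Y₀ : Fin (m + 2) → H} (hY₀ : matAct (secondDiff m) Y₀ = 0) (hm : 0 < m) {B : H →L[ℝ] H}
    (hB : IsAdmissible m (everywhere B)) (hne : everywhere B ≠ T) :
    meanLoss P (observation Y₀ U V) (signal Y₀ V) T <
      meanLoss P (observation Y₀ U V) (signal Y₀ V) (everywhere B) := by
  rw [meanLoss_eq hU hV hUV hT hratio hY₀ hB]
  refine lt_add_of_pos_right _ (lt_of_le_of_ne (integral_nonneg fun ω => gap_nonneg _ _ _) ?_)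
  intro h0
  apply hne
  rw [eq_comm, integral_eq_zero_iff_of_nonneg (fun ω => gap_nonneg _ _ _)
    (integrable_gap hU hV Y₀ hT hB)] at h0
  apply everywhere_eq_of_smoother_eq hm hB hT
  intro x
  rw [← sub_eq_zero]
  refine eq_zero_of_ae_observation_eq_zero hSu hSv hU hV hUV Y₀
    (D := fun x => hT.smoother x - hB.smoother x) (fun x z => ?_) ?_ x
  · rw [pairing_sub_left, pairing_sub_right, hT.pairing_smoother, hB.pairing_smoother]
  · filter_upwards [h0] with ω hω
    exact eq_zero_of_pairing_self_le hω.le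

end Loss

end FunctionalHP

end

/-! ### The main theorem. -/

open FunctionalHP in
theorem theorem1
    {H : Type*} [NormedAddCommGroup H] [InnerProductSpace ℝ H] [CompleteSpace H]
    [MeasurableSpace H] [BorelSpace H] (e : HilbertBasis ℕ ℝ H)
    {Ω : Type*} [MeasurableSpace Ω] (P : Measure Ω) [IsProbabilityMeasure P]
    (m : ℕ)
    -- the deterministic part `Y₀ = Z γ`
    (Z : Matrix (Fin (m + 2)) (Fin 2) ℝ) (hPZ : secondDiff m * Z = 0)
    (hZZ : Z.transpose * Z = 1) (γ : Fin 2 → H)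
    (Y₀ : Fin (m + 2) → H) (hY₀ : Y₀ = matAct Z γ)
    -- the noises and their covariance operators
    (Su Sv : H →L[ℝ] H) (μ τ : ℕ → ℝ)
    (hSu : IsDiagonalCovariance e Su μ) (hSv : IsDiagonalCovariance e Sv τ)
    (U : Fin (m + 2) → Ω → H) (V : Fin m → Ω → H)
    (hU : IsGaussianNoise P U Su) (hV : IsGaussianNoise P V Sv)
    (hUV : IndepFun (fun ω i => U i ω) (fun ω i => V i ω) P)
    -- the signal and the observation
    (Y X : Ω → Fin (m + 2) → H) (hY : Y = signal Y₀ V) (hX : X = observation Y₀ U V)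
    -- the noise-to-signal ratio
    (Bhat : H →ₗ.[ℝ] H) (hBhat : Bhat = diagOp e (fun j => μ j / τ j)) :
    -- `Bhat` is `Su Sv⁻¹` on the range of `Sv`, and it is positive
    (Function.Injective Sv ∧
      ∀ h, ∃ hd : Sv h ∈ Bhat.domain, Bhat ⟨Sv h, hd⟩ = Su h) ∧
    (∀ h : Bhat.domain, 0 ≤ ⟪(h : H), Bhat h⟫) ∧
    -- the smooth signals are well defined
    (∀ x : Fin (m + 2) → H, ∃! y, IsSmoothSignal Bhat x y) ∧
    (∀ B ∈ smoothingOps H, ∀ x : Fin (m + 2) → H, ∃! y, IsSmoothSignal (everywhere B) x y) ∧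
    -- optimality, almost surely
    (∀ᵐ ω ∂P, ∀ B ∈ smoothingOps H, loss P X Y Bhat ω ≤ loss P X Y (everywhere B) ω) ∧
    -- optimality, in mean square
    (Integrable Y P ∧ Integrable (loss P X Y Bhat) P ∧
      ∀ B ∈ smoothingOps H, Integrable (loss P X Y (everywhere B)) P) ∧
    IsGLB ((fun B => meanLoss P X Y (everywhere B)) '' smoothingOps H) (meanLoss P X Y Bhat) ∧
    -- uniqueness among the self-adjoint operators
    (0 < m → ∀ B : H →L[ℝ] H, B.IsPositive → everywhere B ≠ Bhat →
      meanLoss P X Y Bhat < meanLoss P X Y (everywhere B)) ∧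
    -- `Bhat` is one of the bounded operators, and so a minimizer, iff the ratio is bounded
    (BddAbove (range fun j => μ j / τ j) ↔
      ∃ B₀ ∈ smoothingOps H, everywhere B₀ = Bhat ∧
        IsMinOn (fun B => meanLoss P X Y (everywhere B)) (smoothingOps H) B₀) := by
  subst hBhat hY hX
  have := secondCountableTopology_of_hilbertBasis e
  have hratio := hSu.diagOp_div hSv
  have hr : ∀ j, 0 ≤ μ j / τ j := fun j => (div_pos (hSu.pos j) (hSv.pos j)).le
  have hT : IsAdmissible m (diagOp e fun j => μ j / τ j) := isAdmissible_diagOp e m hr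
  have hP : matAct (secondDiff m) Y₀ = 0 := by
    rw [hY₀, ← matAct_mul, hPZ, zero_matAct]
  have hle : ∀ B ∈ smoothingOps H, _ ≤ meanLoss P (observation Y₀ U V) (signal Y₀ V)
      (everywhere B) := fun B hB => meanLoss_le_everywhere hU hV hUV hT hratio hP hB
  refine ⟨⟨hSv.injective, hratio⟩, diagOp_nonneg e hr, hT.existsUnique, fun B hB x => ?_, ?_,
    ⟨(memLp_signal hV Y₀).integrable (by norm_num), integrable_loss hU hV hUV hT hratio hP hT,
      fun B hB => ?_⟩, ⟨?_, fun c hc => ?_⟩, fun hm B hB hne => ?_, fun hb => ?_, ?_⟩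
  · rw [← isSmoothSignal_symmPart]
    exact (isAdmissible_symmPart m hB).existsUnique x
  · filter_upwards [ae_loss_eq hU hV hUV hT hratio hP] with ω hω B hB
    rw [← loss_symmPart, hω _ hT, hω _ (isAdmissible_symmPart m hB), gap_self, add_zero]
    exact le_add_of_nonneg_right (gap_nonneg _ _ _)
  · rw [← loss_symmPart]
    exact integrable_loss hU hV hUV hT hratio hP (isAdmissible_symmPart m hB)
  · rintro _ ⟨B, hB, rfl⟩
    exact hle B hB
  · have hN : ∀ N, IsAdmissible m (everywhere (truncOp e (fun j => μ j / τ j) N)) := fun N =>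
      isAdmissible_everywhere m (truncOp_mem_smoothingOps e hr N) (truncOp_symm e _ N)
    -- A lower bound over the bounded operators applies to every truncation, hence to the limit of
    -- their mean losses.
    exact ge_of_tendsto' (tendsto_meanLoss_truncOp hU hV hUV hT hratio hP hN)
      fun N => hc ⟨_, truncOp_mem_smoothingOps e hr N, rfl⟩
  · exact meanLoss_lt hSu hSv hU hV hUV hT hratio hP hm
      (isAdmissible_everywhere m (fun h => by simpa using hB.inner_nonneg_right h)
        fun g h => hB.isSymmetric g h) hne
  · obtain ⟨B, hB, heq⟩ := exists_everywhere_eq_diagOp e hr hb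
    refine ⟨B, hB, heq, fun B' hB' => ?_⟩
    simpa only [mem_ofPred_eq, heq] using hle B' hB'
  · rintro ⟨B, _, heq, _⟩
    exact bddAbove_of_everywhere_eq_diagOp e heq
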